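/- Let $\mathbb F\in\{\mathbb R,\mathbb C\}$. For a matrix $B$, $B^*$ is its conjugate transpose, $\|B\|$ its operator norm with respect to the Euclidean norms, and $\sigma_k(B)=\sqrt{\lambda_k(B^*B)}$ its $k$-th largest singular value. A rank-$r$ truncated SVD of $B$ is a product $USV^*$ in which $U$ and $V$ consist of the first $r$ left and right singular vectors of some singular value decomposition of $B$ with singular values in non-increasing order, and $S=\operatorname{diag}(\sigma_1(B),\dots,\sigma_r(B))$. For matrices $V,W$ with $r$ orthonormal columns, $\sin(V,W)$ is the diagonal matrix of the sines of the principal angles $\theta_k=\arccos\sigma_k(V^*W)$, $1\le k\le r$. A real random variable $\xi$ has $\|\xi\|_{\psi_2}=\inf\{t>0:\mathbb E e^{|\xi|^2/t^2}\le 2\}$. A mean-zero random vector $y$ in $\mathbb R^p$ with finite second moments is $K$-subgaussian if $\|\langle y,x\rangle\|_{\psi_2}\le K(\mathbb E\langle y,x\rangle^2)^{1/2}$ for all $x\in\mathbb R^p$; a random vector in $\mathbb C^p$ is $K$-subgaussian if its real and imaginary parts are. A random vector $y$ in $\mathbb F^p$ is isotropic if $\mathbb E(yy^*)=I_p$. **Theorem.**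 There is an absolute constant $C>0$, and for every $\tau>0$ there are constants $\alpha_\tau\ge 0$ and $c_\tau>0$ depending only on $\tau$, such that the following holds. Let $p_1,p_2,r$ be integers with $1\le r\le\min\{p_1,p_2\}$, let $X\in\mathbb F^{p_1\times p_2}$ have rank $r$, with rank-$r$ truncated SVD $USV^*$, and let $Z\in\mathbb F^{p_1\times p_2}$ be a random matrix whose rows $z_1^*,\dots,z_{p_1}^*$ are such that $z_1,\dots,z_{p_1}$ are independent, isotropic, $\tau$-subgaussian random vectors. Put $Y=X+Z$. Then for every $\alpha\ge\alpha_\tau$, with probability at least $1-e^{-c_\tau\alpha p_2}$, every rank-$r$ truncated SVD $\hat U\hat S\hat V^*$ of $Y$ satisfies $$\|\sin(V,\hat V)\|^2\le\min\left\{1,\ \frac{C\,\alpha\,p_2\,(\sigma_r^2(X)+p_1)}{\sigma_r^4(X)}\right\}.$$ -/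

import Mathlib

open MeasureTheory ProbabilityTheory
open scoped Matrix ENNReal

noncomputable section

namespace SubspaceSVD

section LinearAlgebra

variable {𝕜 : Type*} [RCLike 𝕜] {m n r : ℕ}

/-- The `k`-th largest singular value `σ_k(A) = √(λ_k(Aᴴ A))` of a matrix, counted from `k = 1`
(Mathlib counts singular values from `0`). For `k > n` it is `0`. -/
def sval (A : Matrix (Fin m) (Fin n) 𝕜) (k : ℕ) : ℝ :=
  (Matrix.toEuclideanLin A).singularValues (k - 1)

/-- The operator norm of a matrix with respect to the Euclidean norms. -/
def opNorm (A : Matrix (Fin m) (Fin n) 𝕜) : ℝ :=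
  ‖LinearMap.toContinuousLinearMap (Matrix.toEuclideanLin A)‖

/-- The `m × n` rectangular diagonal matrix with diagonal `σ_1(A), σ_2(A), …`. -/
def svalMatrix (A : Matrix (Fin m) (Fin n) 𝕜) : Matrix (Fin m) (Fin n) 𝕜 :=
  Matrix.of fun i j => if (i : ℕ) = (j : ℕ) then ((sval A (j + 1) : ℝ) : 𝕜) else 0

/-- `A = U Σ Vᴴ` is a (full) singular value decomposition of `A`: `U` and `V` are unitary, and `Σ`
is the rectangular diagonal matrix of the singular values of `A` in non-increasing order. -/
def IsSVD (A : Matrix (Fin m) (Fin n) 𝕜) (U : Matrix (Fin m) (Fin m) 𝕜)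
    (V : Matrix (Fin n) (Fin n) 𝕜) : Prop :=
  U ∈ Matrix.unitaryGroup (Fin m) 𝕜 ∧ V ∈ Matrix.unitaryGroup (Fin n) 𝕜 ∧
    A = U * svalMatrix A * Vᴴ

/-- `U S Vᴴ` is a rank-`r` truncated singular value decomposition of `A`: for some singular value
decomposition of `A`, the columns of `U` and `V` are the first `r` left and right singular vectors,
and `S = diag(σ_1(A), …, σ_r(A))`. -/
def IsTruncatedSVD (hm : r ≤ m) (hn : r ≤ n) (A : Matrix (Fin m) (Fin n) 𝕜)
    (U : Matrix (Fin m) (Fin r) 𝕜) (S : Matrix (Fin r) (Fin r) 𝕜)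
    (V : Matrix (Fin n) (Fin r) 𝕜) : Prop :=
  ∃ (U' : Matrix (Fin m) (Fin m) 𝕜) (V' : Matrix (Fin n) (Fin n) 𝕜), IsSVD A U' V' ∧
    U = U'.submatrix id (Fin.castLE hm) ∧
    S = Matrix.diagonal (fun k : Fin r => ((sval A (k + 1) : ℝ) : 𝕜)) ∧
    V = V'.submatrix id (Fin.castLE hn)

/-- The `k`-th principal angle (`k = 0, …, r - 1`) between the column spaces of two matrices `V`
and `W` with `r` orthonormal columns; its cosine is the singular value `σ_{k+1}(Vᴴ W)`. -/
def principalAngle (V W : Matrix (Fin n) (Fin r) 𝕜) (k : Fin r) : ℝ :=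
  Real.arccos (sval (Vᴴ * W) (k + 1))

/-- The diagonal matrix `sin(V, W)` of the sines of the principal angles. -/
def sinMatrix (V W : Matrix (Fin n) (Fin r) 𝕜) : Matrix (Fin r) (Fin r) ℝ :=
  Matrix.diagonal fun k => Real.sin (principalAngle V W k)

end LinearAlgebra

section Probability

variable {Ω : Type*} [MeasurableSpace Ω]

/-- The `ψ₂`-norm `inf {t > 0 : 𝔼 exp(|X|² / t²) ≤ 2}` of a real random variable
(infinite if there is no such `t`). -/
def psiTwoNorm (X : Ω → ℝ) (μ : Measure Ω) : ℝ≥0∞ :=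
  ⨅ (t : ℝ) (_ : 0 < t ∧ ∫⁻ ω, ENNReal.ofReal (Real.exp (|X ω| ^ 2 / t ^ 2)) ∂μ ≤ 2),
    ENNReal.ofReal t

/-- A square-integrable mean-zero random vector `y` in `ℝ^p` is `K`-subgaussian if
`‖⟨y, x⟩‖_{ψ₂} ≤ K ‖⟨y, x⟩‖_{L₂}` for all `x ∈ ℝ^p`. -/
def IsSubgaussianReal {p : ℕ} (K : ℝ) (y : Ω → Fin p → ℝ) (μ : Measure Ω) : Prop :=
  (∀ i, MemLp (fun ω => y ω i) 2 μ) ∧ (∀ i, ∫ ω, y ω i ∂μ = 0) ∧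
    ∀ x : Fin p → ℝ, psiTwoNorm (fun ω => y ω ⬝ᵥ x) μ ≤
      ENNReal.ofReal K * eLpNorm (fun ω => y ω ⬝ᵥ x) 2 μ

/-- A random vector in `𝔽^p` is `K`-subgaussian if its real and imaginary parts are
(over `ℝ` the imaginary part is zero and its condition is void). -/
def IsSubgaussian {𝕜 : Type*} [RCLike 𝕜] {p : ℕ} (K : ℝ) (y : Ω → Fin p → 𝕜)
    (μ : Measure Ω) : Prop :=
  IsSubgaussianReal K (fun ω i => RCLike.re (y ω i)) μ ∧
    IsSubgaussianReal K (fun ω i => RCLike.im (y ω i)) μ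

/-- A square-integrable random vector `y` in `𝔽^p` is isotropic if `𝔼 (y yᴴ) = I_p`. -/
def IsIsotropic {𝕜 : Type*} [RCLike 𝕜] {p : ℕ} (y : Ω → Fin p → 𝕜) (μ : Measure Ω) : Prop :=
  (∀ i, MemLp (fun ω => y ω i) 2 μ) ∧
    ∀ i j, ∫ ω, y ω i * star (y ω j) ∂μ = (1 : Matrix (Fin p) (Fin p) 𝕜) i j

/-- The random vector `z_k` in `𝔽^{p₂}` for which `z_kᴴ` is the `k`-th row of the random
matrix `Z`. -/
def rowVec {𝕜 : Type*} [RCLike 𝕜] {p₁ p₂ : ℕ} (Z : Ω → Matrix (Fin p₁) (Fin p₂) 𝕜)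
    (k : Fin p₁) : Ω → Fin p₂ → 𝕜 :=
  fun ω j => star (Z ω k j)

end Probability

end SubspaceSVD

end

open SubspaceSVD

namespace SubspaceSVD

open Module

/-! ### Singular values, and the scalar inequality for one principal vector. -/

section Deterministic

variable {𝕜 : Type*} [RCLike 𝕜]

/-! Write `Y = X + Z`, `s = σ_r(X)`, `n = p₁`. The noise need not be small, since `ZᴴZ` is about `n
I`. But a multiple of the identity does not rotate right singular vectors, so only two quantities
matter: the deviation of `ZᴴZ` from `n I`, of size `b`, and the cross terms `⟨Xx, Zy⟩`, of size `ρ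
‖Xx‖ ‖y‖`.

Deterministic half (`norm_le_of_perturbation_identity`, `opNorm_sinMatrix_le_of_perturbation`). Let
`v` be a unit vector in the range of `V` realising a principal angle, `u` its component orthogonal
to the range of `V'`, and `h = ‖u‖` the sine. Then `u = h² v + w` with `w` orthogonal to the range
of `V`, so `Xw = 0`. Evaluate `Re⟨Yu, Yv⟩` in two ways. As `u` and `v - u` lie in complementary
spans of right singular vectors of `Y`, it equals `‖Yu‖² ≤ σ_{r+1}(Y)² h² ≤ (n + b) h²`. Expanding
`u`, it equals `h² ‖Yv‖² + Re⟨Yw, Yv⟩`, where `‖Yv‖² ≥ ‖Xv‖² - 2ρ‖Xv‖ + n - b` and the last term is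
at least `-h (ρ‖Xv‖ + b)`. The `n` cancels, one factor `h` divides out, and `h ≲ ρ/s + b/s²`
remains.

Probabilistic half (`exists_event`). With `q = α p₂`, one may take `ρ = √q` and `b = √(qn) + q`: a
Chernoff bound controls the cross terms, Bernstein's inequality controls `‖Zx‖²`, and nets make both
uniform. Cross terms are needed only on the range of `X`, of dimension `r ≤ p₂`, so the union bound
has `25^(2p₂)` pairs and does not see `p₁`; the tail `e^(-cq)` absorbs this for large `α`. The event
does not mention the SVD of `Y`, so all truncated SVDs are covered at once.

Squaring gives the order `q/s² + qn/s⁴`. If the smallness needed in the deterministic half fails,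
the claimed bound is at least `1` and nothing is to be proved. -/

lemma hasEigenvalue_mul_comm {E : Type*} [AddCommGroup E] [Module 𝕜 E]
    [FiniteDimensional 𝕜 E] (f g : Module.End 𝕜 E) (μ : 𝕜) :
    (f * g).HasEigenvalue μ ↔ (g * f).HasEigenvalue μ := by
  -- Comparing characteristic polynomials also covers the eigenvalue `0`, where carrying an
  -- eigenvector across by `g` could give zero.
  have h : LinearMap.charpoly (f * g) = LinearMap.charpoly (g * f) := by
    let b := Module.finBasis 𝕜 E
    rw [← LinearMap.charpoly_toMatrix _ b, ← LinearMap.charpoly_toMatrix _ b,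
      LinearMap.toMatrix_mul, LinearMap.toMatrix_mul, Matrix.charpoly_mul_comm]
  rw [Module.End.hasEigenvalue_iff_isRoot_charpoly, h,
    ← Module.End.hasEigenvalue_iff_isRoot_charpoly]

lemma sval_nonneg {m n : ℕ} (A : Matrix (Fin m) (Fin n) 𝕜) (k : ℕ) : 0 ≤ sval A k :=
  LinearMap.singularValues_nonneg _ _

/-- Truncated subtraction makes the value at `0` equal to the value at `1`, so monotonicity holds on
all of `ℕ`. -/
lemma sval_antitone {m n : ℕ} (A : Matrix (Fin m) (Fin n) 𝕜) : Antitone (sval A) := fun _ _ h =>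
  LinearMap.singularValues_antitone _ (Nat.sub_le_sub_right h 1)

lemma finrank_range_toEuclideanLin {m n : ℕ} (A : Matrix (Fin m) (Fin n) 𝕜) :
    finrank 𝕜 (LinearMap.range (Matrix.toEuclideanLin A)) = A.rank := by
  rw [Matrix.rank_eq_finrank_range_toLin A (EuclideanSpace.basisFun (Fin m) 𝕜).toBasis
    (EuclideanSpace.basisFun (Fin n) 𝕜).toBasis, Matrix.toEuclideanLin_eq_toLin_orthonormal]

lemma sval_succ_eq_zero {m n : ℕ} (A : Matrix (Fin m) (Fin n) 𝕜) {k : ℕ} (hk : A.rank ≤ k) :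
    sval A (k + 1) = 0 := by
  rw [sval, Nat.add_sub_cancel, LinearMap.singularValues_eq_zero_iff_le_finrank_range,
    finrank_range_toEuclideanLin]
  exact hk

lemma sval_pos {m n : ℕ} (A : Matrix (Fin m) (Fin n) 𝕜) {k : ℕ} (hk : 1 ≤ k) (hk' : k ≤ A.rank) :
    0 < sval A k := by
  rw [sval, LinearMap.singularValues_pos_iff_lt_finrank_range, finrank_range_toEuclideanLin]
  omega

lemma svalMatrix_conjTranspose_mul_self {m n : ℕ} (A : Matrix (Fin m) (Fin n) 𝕜) :
    (svalMatrix A)ᴴ * svalMatrix A =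
      Matrix.diagonal fun j : Fin n => ((sval A (j + 1) ^ 2 : ℝ) : 𝕜) := by
  ext i j
  rw [Matrix.mul_apply, Matrix.diagonal_apply]
  simp only [svalMatrix, Matrix.conjTranspose_apply, Matrix.of_apply]
  by_cases hi : (i : ℕ) < m
  · rw [Finset.sum_eq_single ⟨i, hi⟩]
    · by_cases hij : i = j
      · subst hij; simp [pow_two]
      · have : (i : ℕ) ≠ j := fun h => hij (Fin.ext h)
        simp [this, hij]
    · intro k _ hk
      have : (k : ℕ) ≠ i := fun h => hk (Fin.ext h)
      simp [this]
    · simp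
  -- For `i ≥ m` the column of the rectangular diagonal is zero; the right side agrees because the
  -- rank is at most `m`.
  · have h0 : ∀ k : Fin m, (k : ℕ) ≠ i := fun k h => hi (h ▸ k.2)
    have : sval A (i + 1) = 0 := sval_succ_eq_zero A ((Matrix.rank_le_height A).trans (by omega))
    simp [h0, this]

/-- The right singular vectors of a matrix. -/
lemma IsSVD.exists_basis {m n : ℕ} {A : Matrix (Fin m) (Fin n) 𝕜} {U : Matrix (Fin m) (Fin m) 𝕜}
    {V : Matrix (Fin n) (Fin n) 𝕜} (h : IsSVD A U V) :
    ∃ b : OrthonormalBasis (Fin n) 𝕜 (EuclideanSpace 𝕜 (Fin n)),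
      (∀ i j, b j i = V i j) ∧
      ∀ i j, inner 𝕜 (Matrix.toEuclideanLin A (b i)) (Matrix.toEuclideanLin A (b j)) =
        if i = j then ((sval A (i + 1) ^ 2 : ℝ) : 𝕜) else 0 := by
  obtain ⟨hU, hV, hA⟩ := h
  have hin : ∀ {k l : ℕ} (B : Matrix (Fin k) (Fin l) 𝕜) (i j : Fin l),
      inner 𝕜 (WithLp.toLp 2 (B.col i) : EuclideanSpace 𝕜 (Fin k)) (WithLp.toLp 2 (B.col j))
        = (Bᴴ * B) i j := by
    intro k l B i j
    simp [PiLp.inner_apply, Matrix.mul_apply, Matrix.col, mul_comm]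
  have hVV : Vᴴ * V = 1 := Matrix.mem_unitaryGroup_iff'.1 hV
  have hUU : Uᴴ * U = 1 := Matrix.mem_unitaryGroup_iff'.1 hU
  have ho : Orthonormal 𝕜 fun j => (WithLp.toLp 2 (V.col j) : EuclideanSpace 𝕜 (Fin n)) := by
    rw [orthonormal_iff_ite]
    intro i j
    rw [hin, hVV, Matrix.one_apply]
  let b : OrthonormalBasis (Fin n) 𝕜 (EuclideanSpace 𝕜 (Fin n)) :=
    OrthonormalBasis.mk ho (by
      rw [(ho.linearIndependent.span_eq_top_of_card_eq_finrank' (by simp))])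
  have hb : ∀ j, b j = WithLp.toLp 2 (V.col j) := fun j => by simp [b]
  refine ⟨b, fun i j => by rw [hb]; rfl, fun i j => ?_⟩
  have hc : ∀ j, Matrix.toEuclideanLin A (b j) = WithLp.toLp 2 ((A * V).col j) := by
    intro j
    rw [hb, Matrix.toLpLin_toLp]
    rfl
  have : (A * V)ᴴ * (A * V) = (svalMatrix A)ᴴ * svalMatrix A := by
    have : A * V = U * svalMatrix A := by
      conv_lhs => rw [hA]
      rw [Matrix.mul_assoc, hVV, Matrix.mul_one]
    rw [this, Matrix.conjTranspose_mul, Matrix.mul_assoc, ← Matrix.mul_assoc Uᴴ, hUU,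
      Matrix.one_mul]
  rw [hc, hc, hin, this, svalMatrix_conjTranspose_mul_self, Matrix.diagonal_apply]

variable {E F : Type*} [NormedAddCommGroup E] [InnerProductSpace 𝕜 E]
  [NormedAddCommGroup F] [InnerProductSpace 𝕜 F]

/-- All that is used of an SVD is an orthonormal basis whose images are orthogonal with norms `s i`;
left singular vectors never enter. -/
lemma inner_map_eq_sum {n : ℕ} (T : E →ₗ[𝕜] F) (b : OrthonormalBasis (Fin n) 𝕜 E) (s : Fin n → ℝ)
    (h : ∀ i j, inner 𝕜 (T (b i)) (T (b j)) = if i = j then ((s i ^ 2 : ℝ) : 𝕜) else 0) (x y : E) :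
    inner 𝕜 (T x) (T y) =
      ∑ i, ((s i ^ 2 : ℝ) : 𝕜) * (inner 𝕜 x (b i) * inner 𝕜 (b i) y) := by
  conv_lhs => rw [← b.sum_repr' x, ← b.sum_repr' y]
  simp only [map_sum, map_smul, sum_inner, inner_sum, inner_smul_left, inner_smul_right, h]
  refine Finset.sum_congr rfl fun i _ => ?_
  simp
  ring

lemma norm_sq_map_eq_sum {n : ℕ} (T : E →ₗ[𝕜] F) (b : OrthonormalBasis (Fin n) 𝕜 E)
    (s : Fin n → ℝ)
    (h : ∀ i j, inner 𝕜 (T (b i)) (T (b j)) = if i = j then ((s i ^ 2 : ℝ) : 𝕜) else 0) (x : E) :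
    ‖T x‖ ^ 2 = ∑ i, s i ^ 2 * ‖inner 𝕜 (b i) x‖ ^ 2 := by
  have := inner_map_eq_sum T b s h x x
  rw [inner_self_eq_norm_sq_to_K] at this
  have h2 : ∀ i, inner 𝕜 x (b i) * inner 𝕜 (b i) x = ((‖inner 𝕜 (b i) x‖ ^ 2 : ℝ) : 𝕜) := by
    intro i
    rw [← inner_conj_symm x, RCLike.conj_mul]
    simp
  simp only [h2] at this
  exact_mod_cast this

/-- The scalar inequality behind the sine bound, for a unit principal vector `v` with residual
`u = h² v + w`. -/
lemma norm_le_of_perturbation_identity (X Z : E →ₗ[𝕜] F) {p b ρ s h : ℝ} {u v w : E}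
    (hs : 0 < s) (hρ : 0 ≤ ρ) (hρs : 16 * ρ ≤ s) (hb : 0 ≤ b) (hbs : 16 * b ≤ s ^ 2)
    (hA : ∀ x y, |RCLike.re (inner 𝕜 (X x) (Z y))| ≤ ρ * ‖X x‖ * ‖y‖)
    (hB : ∀ x y, |RCLike.re (inner 𝕜 (Z x) (Z y)) - p * RCLike.re (inner 𝕜 x y)| ≤ b * ‖x‖ * ‖y‖)
    (hh : 0 ≤ h) (hv : ‖v‖ = 1) (hXv : s ≤ ‖X v‖) (huv : u = ((h ^ 2 : ℝ) : 𝕜) • v + w)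
    (hw : ‖w‖ ≤ h) (hXw : X w = 0) (hwv : RCLike.re (inner 𝕜 w v) = 0)
    (hY : RCLike.re (inner 𝕜 ((X + Z) u) ((X + Z) v)) ≤ (p + b) * h ^ 2) :
    h ≤ 4 / 3 * (ρ / s + b / s ^ 2) := by
  set t := ‖X v‖
  have hYv : t ^ 2 - 2 * (ρ * t) + p - b ≤ ‖(X + Z) v‖ ^ 2 := by
    have h1 := abs_le.1 (hA v v)
    have h2 := abs_le.1 (hB v v)
    rw [inner_self_eq_norm_sq, inner_self_eq_norm_sq, hv] at h2
    rw [hv] at h1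
    rw [LinearMap.add_apply, @norm_add_sq 𝕜]
    nlinarith
  have hwv' : -(ρ * t * h + b * h) ≤ RCLike.re (inner 𝕜 ((X + Z) w) ((X + Z) v)) := by
    have h1 := abs_le.1 (hA v w)
    have h2 := abs_le.1 (hB w v)
    rw [hv, hwv] at h2
    rw [LinearMap.add_apply, LinearMap.add_apply, hXw, zero_add, inner_add_right, map_add,
      inner_re_symm]
    have h3 : ρ * t * ‖w‖ ≤ ρ * t * h := by gcongr
    have h4 : b * ‖w‖ ≤ b * h := by gcongr
    linarith [h1.1, h2.1]
  have hsum : RCLike.re (inner 𝕜 ((X + Z) u) ((X + Z) v)) =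
      h ^ 2 * ‖(X + Z) v‖ ^ 2 + RCLike.re (inner 𝕜 ((X + Z) w) ((X + Z) v)) := by
    rw [huv, map_add, map_smul, inner_add_left, map_add, inner_smul_left, RCLike.conj_ofReal,
      RCLike.re_ofReal_mul, inner_self_eq_norm_sq]
  -- The `p` cancels between `hY` and `hYv`. Since `16ρ ≤ s ≤ t` and `16b ≤ s² ≤ t²`, the losses
  -- `2ρt` and `2b` are at most `t²/8` each, which leaves `3/4 t²`.
  have key : h * (h * (3 / 4 * t ^ 2)) ≤ h * (ρ * t + b) := by
    have h1 : h ^ 2 * (t ^ 2 - 2 * (ρ * t) + p - b) ≤ h ^ 2 * ‖(X + Z) v‖ ^ 2 := by gcongr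
    have h2 : ρ * t ≤ t ^ 2 / 16 := by nlinarith
    have h3 : b ≤ t ^ 2 / 16 := by nlinarith
    have h4 : h ^ 2 * (3 / 4 * t ^ 2) ≤ h ^ 2 * (t ^ 2 - 2 * (ρ * t) - 2 * b) := by
      gcongr
      linarith
    nlinarith
  rcases hh.eq_or_lt with rfl | hpos
  · positivity
  have key2 := le_of_mul_le_mul_left key hpos
  have ht : 0 < t := hs.trans_le hXv
  have : h ≤ 4 / 3 * (ρ / t + b / t ^ 2) := by
    have : 4 / 3 * (ρ / t + b / t ^ 2) = (4 / 3 * (ρ * t + b)) / t ^ 2 := by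
      field_simp
    rw [this, le_div_iff₀ (by positivity)]
    linarith
  refine this.trans ?_
  gcongr

end Deterministic

end SubspaceSVD

namespace SubspaceSVD

open Module

/-! ### Principal vectors and the deterministic sine bound. -/

section SinTheta

variable {𝕜 : Type*} [RCLike 𝕜]

open scoped Matrix.Norms.L2Operator in
lemma opNorm_sinMatrix_le {n r : ℕ} {V W : Matrix (Fin n) (Fin r) 𝕜} {B : ℝ} (hB : 0 ≤ B)
    (h : ∀ k : Fin r, √(1 - sval (Vᴴ * W) (k + 1) ^ 2) ≤ B) : opNorm (sinMatrix V W) ≤ B := by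
  have : opNorm (sinMatrix V W) = ‖sinMatrix V W‖ := rfl
  rw [this, sinMatrix, Matrix.l2_opNorm_diagonal, pi_norm_le_iff_of_nonneg hB]
  intro k
  rw [principalAngle, Real.sin_arccos, Real.norm_of_nonneg (Real.sqrt_nonneg _)]
  exact h k

section Frame

variable {n r : ℕ} (h : r ≤ n) {V : Matrix (Fin n) (Fin r) 𝕜}
  (b : OrthonormalBasis (Fin n) 𝕜 (EuclideanSpace 𝕜 (Fin n)))

lemma toEuclideanLin_conjTranspose_apply (hV : ∀ i j, b (Fin.castLE h j) i = V i j)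
    (x : EuclideanSpace 𝕜 (Fin n)) (j : Fin r) :
    Matrix.toEuclideanLin Vᴴ x j = inner 𝕜 (b (Fin.castLE h j)) x := by
  simp [PiLp.inner_apply, hV, Matrix.ofLp_toLpLin, Matrix.mulVec, dotProduct, mul_comm]

lemma inner_toEuclideanLin_left (y : EuclideanSpace 𝕜 (Fin r)) (x : EuclideanSpace 𝕜 (Fin n)) :
    inner 𝕜 (Matrix.toEuclideanLin V y) x = inner 𝕜 y (Matrix.toEuclideanLin Vᴴ x) := by
  rw [Matrix.toEuclideanLin_conjTranspose_eq_adjoint, LinearMap.adjoint_inner_right]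

lemma inner_basis_toEuclideanLin_eq_zero (hV : ∀ i j, b (Fin.castLE h j) i = V i j)
    (y : EuclideanSpace 𝕜 (Fin r)) {i : Fin n} (hi : r ≤ i) :
    inner 𝕜 (b i) (Matrix.toEuclideanLin V y) = 0 := by
  rw [← inner_conj_symm, inner_toEuclideanLin_left]
  have : Matrix.toEuclideanLin Vᴴ (b i) = 0 := by
    ext j
    rw [toEuclideanLin_conjTranspose_apply h b hV, b.inner_eq_ite, if_neg]
    · rfl
    · rintro rfl
      have := j.2
      simp only [Fin.val_castLE] at hi
      omega
  rw [this]
  simp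

lemma conjTranspose_mul_self_eq_one (hV : ∀ i j, b (Fin.castLE h j) i = V i j) : Vᴴ * V = 1 := by
  ext i j
  have := b.inner_eq_ite (Fin.castLE h i) (Fin.castLE h j)
  simp only [PiLp.inner_apply, hV, RCLike.inner_apply] at this
  rw [Matrix.mul_apply, Matrix.one_apply]
  simp only [Matrix.conjTranspose_apply, RCLike.star_def]
  simp only [(Fin.castLE_injective h).eq_iff] at this
  rw [← this]
  exact Finset.sum_congr rfl fun _ _ => mul_comm _ _

lemma toEuclideanLin_conjTranspose_toEuclideanLin (hV : Vᴴ * V = 1)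
    (y : EuclideanSpace 𝕜 (Fin r)) :
    Matrix.toEuclideanLin Vᴴ (Matrix.toEuclideanLin V y) = y := by
  rw [← LinearMap.comp_apply, ← Matrix.toLpLin_mul, hV, Matrix.toLpLin_one, LinearMap.id_apply]

lemma inner_basis_eq_zero_of_toEuclideanLin (hV : ∀ i j, b (Fin.castLE h j) i = V i j)
    {x : EuclideanSpace 𝕜 (Fin n)} (hx : Matrix.toEuclideanLin Vᴴ x = 0) {i : Fin n}
    (hi : (i : ℕ) < r) : inner 𝕜 (b i) x = 0 := by
  have := toEuclideanLin_conjTranspose_apply h b hV x ⟨i, hi⟩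
  rw [hx] at this
  exact this.symm

end Frame

/-- Principal vectors: `σ_{k+1}(Vᴴ W)` is the cosine of an angle between a unit vector of the range
of `V` and the range of `W`. -/
lemma exists_principal_vector {n r : ℕ} {V W : Matrix (Fin n) (Fin r) 𝕜} (hV : Vᴴ * V = 1)
    (hW : Wᴴ * W = 1) (k : Fin r) :
    ∃ (y y' : EuclideanSpace 𝕜 (Fin r)) (v u w : EuclideanSpace 𝕜 (Fin n)),
      v = Matrix.toEuclideanLin V y ∧ v - u = Matrix.toEuclideanLin W y' ∧ ‖v‖ = 1 ∧
      ‖u‖ = √(1 - sval (Vᴴ * W) (k + 1) ^ 2) ∧ u = ((‖u‖ ^ 2 : ℝ) : 𝕜) • v + w ∧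
      Matrix.toEuclideanLin Vᴴ w = 0 ∧ Matrix.toEuclideanLin Wᴴ u = 0 := by
  set T := Matrix.toEuclideanLin (Vᴴ * W) with hT
  set σ := sval (Vᴴ * W) (k + 1) with hσ
  have hk : (k : ℕ) < finrank 𝕜 (EuclideanSpace 𝕜 (Fin r)) := by simp
  have hev := T.hasEigenvalue_adjoint_comp_self_sq_singularValues hk
  -- The eigenvector must live in the coordinates of `V`, hence `T T*` rather than `T* T`.
  have hev2 : Module.End.HasEigenvalue (T ∘ₗ LinearMap.adjoint T) ((σ : 𝕜) ^ 2) :=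
    (hasEigenvalue_mul_comm (LinearMap.adjoint T) T _).1 hev
  obtain ⟨y₀, hy₀⟩ := hev2.exists_hasEigenvector
  obtain ⟨y, hy1, hy⟩ : ∃ y : EuclideanSpace 𝕜 (Fin r), ‖y‖ = 1 ∧
      T (LinearMap.adjoint T y) = ((σ : 𝕜) ^ 2) • y := by
    refine ⟨((‖y₀‖⁻¹ : ℝ) : 𝕜) • y₀, ?_, ?_⟩
    · have := hy₀.2
      rw [norm_smul, RCLike.norm_ofReal, abs_of_nonneg (by positivity),
        inv_mul_cancel₀ (norm_ne_zero_iff.2 this)]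
    · have : T (LinearMap.adjoint T y₀) = ((σ : 𝕜) ^ 2) • y₀ := hy₀.apply_eq_smul
      rw [map_smul, map_smul, this, smul_comm]
  set LV := Matrix.toEuclideanLin V
  set LW := Matrix.toEuclideanLin W
  set LV' := Matrix.toEuclideanLin Vᴴ
  set LW' := Matrix.toEuclideanLin Wᴴ
  have hVid : ∀ y, LV' (LV y) = y := toEuclideanLin_conjTranspose_toEuclideanLin hV
  have hWid : ∀ y, LW' (LW y) = y := toEuclideanLin_conjTranspose_toEuclideanLin hW
  have hVadj : ∀ y x, inner 𝕜 (LV y) x = inner 𝕜 y (LV' x) := inner_toEuclideanLin_left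
  have hWadj : ∀ y x, inner 𝕜 (LW y) x = inner 𝕜 y (LW' x) := inner_toEuclideanLin_left
  have hTT : T (LinearMap.adjoint T y) = LV' (LW (LW' (LV y))) := by
    rw [hT, ← Matrix.toEuclideanLin_conjTranspose_eq_adjoint, Matrix.conjTranspose_mul,
      Matrix.conjTranspose_conjTranspose, Matrix.toLpLin_mul (q := 2), Matrix.toLpLin_mul (q := 2)]
    rfl
  rw [hTT] at hy
  have hv1 : ‖LV y‖ = 1 := by
    have : (inner 𝕜 (LV y) (LV y) : 𝕜) = inner 𝕜 y y := by rw [hVadj, hVid]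
    rw [@norm_eq_sqrt_re_inner 𝕜, this, ← @norm_eq_sqrt_re_inner 𝕜, hy1]
  have hq : inner 𝕜 (LV y) (LW (LW' (LV y))) = ((σ ^ 2 : ℝ) : 𝕜) := by
    rw [hVadj, hy, inner_smul_right, inner_self_eq_norm_sq_to_K, hy1]
    simp
  have hqq : ‖LW (LW' (LV y))‖ ^ 2 = σ ^ 2 := by
    rw [← @inner_self_eq_norm_sq 𝕜, hWadj, hWid, ← hWadj, ← inner_conj_symm, hq]
    simp
  have hu2 : ‖LV y - LW (LW' (LV y))‖ ^ 2 = 1 - σ ^ 2 := by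
    rw [@norm_sub_sq 𝕜, hqq, hq, hv1]
    simp only [RCLike.ofReal_re]
    ring
  -- `v - u` is the projection of `v = Vy` onto the range of `W`. The eigenvalue equation gives `Vᴴu
  -- = (1 - σ²) y = ‖u‖² y`, so removing `‖u‖² v` from `u` leaves a `w` killed by `Vᴴ`.
  refine ⟨y, LW' (LV y), LV y, LV y - LW (LW' (LV y)),
    LV y - LW (LW' (LV y)) - ((‖LV y - LW (LW' (LV y))‖ ^ 2 : ℝ) : 𝕜) • LV y,
    rfl, by abel, hv1, ?_, by abel, ?_, ?_⟩
  · rw [← hu2, Real.sqrt_sq (norm_nonneg _)]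
  · rw [hu2, map_sub, map_sub, map_smul, hVid, hy]
    simp only [RCLike.ofReal_sub, RCLike.ofReal_one, RCLike.ofReal_pow]
    module
  · rw [map_sub, hWid, sub_self]

/-- If `A = B` on a subspace on which `B` is small, the singular values of `A` beyond its
codimension are small. -/
lemma sval_sq_le_of_ker {m n r : ℕ} {X Z : Matrix (Fin m) (Fin n) 𝕜} (hX : X.rank = r) {c : ℝ}
    (hc : 0 ≤ c) (hZ : ∀ x, ‖Matrix.toEuclideanLin Z x‖ ^ 2 ≤ c * ‖x‖ ^ 2)
    (b : OrthonormalBasis (Fin n) 𝕜 (EuclideanSpace 𝕜 (Fin n)))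
    (hb : ∀ i j, inner 𝕜 (Matrix.toEuclideanLin (X + Z) (b i)) (Matrix.toEuclideanLin (X + Z) (b j))
      = if i = j then ((sval (X + Z) (i + 1) ^ 2 : ℝ) : 𝕜) else 0) :
    sval (X + Z) (r + 1) ^ 2 ≤ c := by
  rcases le_or_gt n r with hn | hn
  · rw [sval_succ_eq_zero _ ((Matrix.rank_le_width _).trans hn)]
    simpa using hc
  set K := LinearMap.ker (Matrix.toEuclideanLin X)
  let f : Fin (r + 1) → EuclideanSpace 𝕜 (Fin n) := fun i => b (Fin.castLE hn i)
  have hf : LinearIndependent 𝕜 f :=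
    b.orthonormal.linearIndependent.comp _ (Fin.castLE_injective hn)
  have h1 : finrank 𝕜 (Submodule.span 𝕜 (Set.range f)) = r + 1 := by
    rw [finrank_span_eq_card hf, Fintype.card_fin]
  have h2 : r + finrank 𝕜 K = n := by
    have := LinearMap.finrank_range_add_finrank_ker (Matrix.toEuclideanLin X)
    rwa [finrank_range_toEuclideanLin, hX, finrank_euclideanSpace_fin] at this
  have h3 := Submodule.finrank_sup_add_finrank_inf_eq (Submodule.span 𝕜 (Set.range f)) K
  have h4 := Submodule.finrank_le (Submodule.span 𝕜 (Set.range f) ⊔ K)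
  rw [finrank_euclideanSpace_fin] at h4
  -- Dimension count: the first `r + 1` right singular vectors of `X + Z` span a space that must
  -- meet `ker X`, of dimension `n - r`. On a common vector `X + Z` acts as `Z`.
  have h5 : Submodule.span 𝕜 (Set.range f) ⊓ K ≠ ⊥ := by
    intro h
    rw [h, finrank_bot] at h3
    omega
  obtain ⟨z, hz, hz0⟩ := Submodule.exists_mem_ne_zero_of_ne_bot h5
  have hzK : Matrix.toEuclideanLin X z = 0 := hz.2
  have hzb : ∀ i : Fin n, r < i → inner 𝕜 (b i) z = 0 := by
    intro i hi
    refine Submodule.span_induction (p := fun x _ => inner 𝕜 (b i) x = 0) ?_ (by simp) ?_ ?_ hz.1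
    · rintro _ ⟨j, rfl⟩
      rw [b.inner_eq_ite, if_neg]
      rintro rfl
      have := j.2
      simp at hi
      omega
    · intro x y _ _ hx hy
      rw [inner_add_right, hx, hy, add_zero]
    · intro a x _ hx
      rw [inner_smul_right, hx, mul_zero]
  have h6 := norm_sq_map_eq_sum (Matrix.toEuclideanLin (X + Z)) b _ hb z
  rw [map_add, LinearMap.add_apply, hzK, zero_add] at h6
  have h7 : sval (X + Z) (r + 1) ^ 2 * ‖z‖ ^ 2 ≤ ‖Matrix.toEuclideanLin Z z‖ ^ 2 := by
    rw [h6, ← b.sum_sq_norm_inner_right z, Finset.mul_sum]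
    refine Finset.sum_le_sum fun i _ => ?_
    rcases lt_or_ge r (i : ℕ) with hi | hi
    · simp [hzb i hi]
    · have := sval_antitone (X + Z) (show (i : ℕ) + 1 ≤ r + 1 by omega)
      have := sval_nonneg (X + Z) (r + 1)
      gcongr
  have h8 : 0 < ‖z‖ ^ 2 := by positivity
  exact le_of_mul_le_mul_right (h7.trans (hZ z)) h8

/-- The deterministic perturbation bound for the right singular subspace. -/
lemma opNorm_sinMatrix_le_of_perturbation {p₁ p₂ r : ℕ} (hr : 1 ≤ r) (h₁ : r ≤ p₁) (h₂ : r ≤ p₂)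
    {X Z : Matrix (Fin p₁) (Fin p₂) 𝕜} {U U' : Matrix (Fin p₁) (Fin r) 𝕜}
    {S S' : Matrix (Fin r) (Fin r) 𝕜} {V V' : Matrix (Fin p₂) (Fin r) 𝕜} (hX : X.rank = r)
    (hSVD : IsTruncatedSVD h₁ h₂ X U S V) (hSVD' : IsTruncatedSVD h₁ h₂ (X + Z) U' S' V')
    {p b ρ : ℝ} (hp : 0 ≤ p) (hρ : 0 ≤ ρ) (hρs : 16 * ρ ≤ sval X r) (hb : 0 ≤ b)
    (hbs : 16 * b ≤ sval X r ^ 2)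
    (hA : ∀ x y, |RCLike.re (inner 𝕜 (Matrix.toEuclideanLin X x) (Matrix.toEuclideanLin Z y))| ≤
      ρ * ‖Matrix.toEuclideanLin X x‖ * ‖y‖)
    (hB : ∀ x y, |RCLike.re (inner 𝕜 (Matrix.toEuclideanLin Z x) (Matrix.toEuclideanLin Z y)) -
      p * RCLike.re (inner 𝕜 x y)| ≤ b * ‖x‖ * ‖y‖) :
    opNorm (sinMatrix V V') ≤ 4 / 3 * (ρ / sval X r + b / sval X r ^ 2) := by
  have hs : 0 < sval X r := sval_pos X hr hX.ge
  obtain ⟨_, Vf, hf, -, -, hVf⟩ := hSVD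
  obtain ⟨_, Vg, hg, -, -, hVg⟩ := hSVD'
  obtain ⟨e, he, heX⟩ := hf.exists_basis
  obtain ⟨e', he', heY⟩ := hg.exists_basis
  have hV : ∀ i j, e (Fin.castLE h₂ j) i = V i j := fun i j => by rw [he, hVf]; rfl
  have hV' : ∀ i j, e' (Fin.castLE h₂ j) i = V' i j := fun i j => by rw [he', hVg]; rfl
  refine opNorm_sinMatrix_le (by positivity) fun k => ?_
  obtain ⟨y, y', v, u, w, hv, hvu, hv1, hu, huv, hw, hu'⟩ := exists_principal_vector
    (conjTranspose_mul_self_eq_one h₂ e hV) (conjTranspose_mul_self_eq_one h₂ e' hV') k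
  have hwv : inner 𝕜 v w = 0 := by
    rw [hv, inner_toEuclideanLin_left, hw, inner_zero_right]
  have hZ : ∀ x, ‖Matrix.toEuclideanLin Z x‖ ^ 2 ≤ (p + b) * ‖x‖ ^ 2 := by
    intro x
    have := (abs_le.1 (hB x x)).2
    rw [inner_self_eq_norm_sq, inner_self_eq_norm_sq] at this
    linarith
  have hσ := sval_sq_le_of_ker hX (add_nonneg hp hb) hZ e' heY
  rw [← hu]
  refine norm_le_of_perturbation_identity (Matrix.toEuclideanLin X) (Matrix.toEuclideanLin Z)
    (p := p) (v := v) (u := u) (w := w) hs hρ hρs hb hbs hA hB (norm_nonneg _) hv1 ?_ huv ?_ ?_ ?_ ?_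
  · have h := norm_sq_map_eq_sum _ e _ heX v
    have h' : sval X r ^ 2 * ‖v‖ ^ 2 ≤ ‖Matrix.toEuclideanLin X v‖ ^ 2 := by
      rw [h, ← e.sum_sq_norm_inner_right v, Finset.mul_sum]
      refine Finset.sum_le_sum fun i _ => ?_
      rcases le_or_gt r (i : ℕ) with hi | hi
      · rw [hv, inner_basis_toEuclideanLin_eq_zero h₂ e hV y hi]
        simp
      · have := sval_antitone X (show (i : ℕ) + 1 ≤ r by omega)
        gcongr
    rw [hv1, one_pow, mul_one] at h'
    exact le_of_sq_le_sq h' (norm_nonneg _)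
  · have h : ‖u‖ ^ 2 = ‖((‖u‖ ^ 2 : ℝ) : 𝕜) • v‖ ^ 2 + ‖w‖ ^ 2 := by
      conv_lhs => rw [huv, @norm_add_sq 𝕜, inner_smul_left, hwv]
      simp
    refine le_of_sq_le_sq ?_ (norm_nonneg _)
    rw [h]
    exact le_add_of_nonneg_left (by positivity)
  · have h := norm_sq_map_eq_sum _ e _ heX w
    have h' : ‖Matrix.toEuclideanLin X w‖ ^ 2 = 0 := by
      rw [h]
      refine Finset.sum_eq_zero fun i _ => ?_
      rcases le_or_gt r (i : ℕ) with hi | hi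
      · rw [sval_succ_eq_zero X (hX.le.trans hi)]
        simp
      · rw [inner_basis_eq_zero_of_toEuclideanLin h₂ e hV hw hi]
        simp
    simpa using h'
  · rw [inner_re_symm, hwv, map_zero]
  · rw [← map_add]
    -- `v - u` uses only the first `r` right singular vectors of `X + Z` and `u` only the later
    -- ones, so their images are orthogonal.
    have h0 : inner 𝕜 (Matrix.toEuclideanLin (X + Z) u) (Matrix.toEuclideanLin (X + Z) (v - u)) =
        0 := by
      rw [inner_map_eq_sum _ e' _ heY]
      refine Finset.sum_eq_zero fun i _ => ?_
      rcases le_or_gt r (i : ℕ) with hi | hi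
      · rw [hvu, inner_basis_toEuclideanLin_eq_zero h₂ e' hV' y' hi]
        simp
      · rw [← inner_conj_symm u, inner_basis_eq_zero_of_toEuclideanLin h₂ e' hV' hu' hi]
        simp
    rw [map_sub, inner_sub_right, sub_eq_zero] at h0
    rw [h0, inner_self_eq_norm_sq, norm_sq_map_eq_sum _ e' _ heY, ← e'.sum_sq_norm_inner_right u,
      Finset.mul_sum]
    refine Finset.sum_le_sum fun i _ => ?_
    rcases le_or_gt r (i : ℕ) with hi | hi
    · have h1 := sval_antitone (X + Z) (show r + 1 ≤ (i : ℕ) + 1 by omega)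
      have h2 := sval_nonneg (X + Z) ((i : ℕ) + 1)
      have h3 : sval (X + Z) (i + 1) ^ 2 ≤ p + b := (pow_le_pow_left₀ h2 h1 2).trans hσ
      gcongr
    · rw [inner_basis_eq_zero_of_toEuclideanLin h₂ e' hV' hu' hi]
      simp

end SinTheta

end SubspaceSVD

namespace SubspaceSVD

open Module

/-! ### Nets of the unit ball and norms tested on them. -/

section Nets

/-- Doubling gives a `1`-separated set in the ball of radius `2`, the setting of
`Besicovitch.card_le_of_separated`. -/
lemma card_le_of_half_separated {E : Type*} [NormedAddCommGroup E] [NormedSpace ℝ E]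
    [FiniteDimensional ℝ E] (s : Finset E) (hs : ∀ c ∈ s, ‖c‖ ≤ 1)
    (h : ∀ c ∈ s, ∀ d ∈ s, c ≠ d → 1 / 2 ≤ ‖c - d‖) : s.card ≤ 5 ^ finrank ℝ E := by
  classical
  have hinj : Function.Injective fun x : E => (2 : ℝ) • x := smul_right_injective E two_ne_zero
  rw [← Finset.card_image_of_injective s hinj]
  refine Besicovitch.card_le_of_separated _ ?_ ?_
  · intro c hc
    obtain ⟨x, hx, rfl⟩ := Finset.mem_image.1 hc
    have := hs x hx
    simp only [norm_smul, Real.norm_ofNat]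
    linarith
  · intro c hc d hd hcd
    obtain ⟨x, hx, rfl⟩ := Finset.mem_image.1 hc
    obtain ⟨y, hy, rfl⟩ := Finset.mem_image.1 hd
    have := h x hx y hy fun e => hcd (by rw [e])
    simp only [← smul_sub, norm_smul, Real.norm_ofNat]
    linarith

/-- A separated set of maximal cardinality is a net, since a point far from all its members could be
added; the packing bound makes the maximum exist. -/
lemma exists_real_net (E : Type*) [NormedAddCommGroup E] [NormedSpace ℝ E]
    [FiniteDimensional ℝ E] :
    ∃ N : Finset E, N.card ≤ 5 ^ finrank ℝ E ∧ (∀ x ∈ N, ‖x‖ ≤ 1) ∧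
      ∀ x : E, ‖x‖ ≤ 1 → ∃ y ∈ N, ‖x - y‖ ≤ 1 / 2 := by
  classical
  let P : ℕ → Prop := fun k => ∃ s : Finset E, s.card = k ∧ (∀ c ∈ s, ‖c‖ ≤ 1) ∧
    ∀ c ∈ s, ∀ d ∈ s, c ≠ d → 1 / 2 ≤ ‖c - d‖
  have hP0 : P 0 := ⟨∅, by simp⟩
  obtain ⟨s, hsc, hs1, hs2⟩ := Nat.findGreatest_spec (P := P) (Nat.zero_le (5 ^ finrank ℝ E)) hP0
  refine ⟨s, card_le_of_half_separated s hs1 hs2, hs1, fun x hx => ?_⟩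
  by_contra! hcon
  have hxs : x ∉ s := fun hxs => by
    have := hcon x hxs
    norm_num at this
  have hP : P (s.card + 1) := by
    refine ⟨insert x s, Finset.card_insert_of_notMem hxs, ?_, ?_⟩
    · intro c hc
      rcases Finset.mem_insert.1 hc with rfl | hc
      · exact hx
      · exact hs1 c hc
    · intro c hc d hd hcd
      rcases Finset.mem_insert.1 hc with rfl | hcs
      · rcases Finset.mem_insert.1 hd with rfl | hd
        · exact absurd rfl hcd
        · exact (hcon d hd).le
      · rcases Finset.mem_insert.1 hd with rfl | hd
        · rw [norm_sub_rev]
          exact (hcon c hcs).le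
        · exact hs2 c hcs d hd hcd
  have hle : s.card + 1 ≤ 5 ^ finrank ℝ E := by
    obtain ⟨t, ht, ht1, ht2⟩ := hP
    rw [← ht]
    exact card_le_of_half_separated t ht1 ht2
  have := Nat.le_findGreatest hle hP
  omega

/-- The base becomes `25 = 5²` because the real dimension is at most twice the dimension over `𝕜`.
-/
lemma exists_net (𝕜 E : Type*) [RCLike 𝕜] [NormedAddCommGroup E] [NormedSpace 𝕜 E]
    [FiniteDimensional 𝕜 E] :
    ∃ N : Finset E, N.card ≤ 25 ^ finrank 𝕜 E ∧ (∀ x ∈ N, ‖x‖ ≤ 1) ∧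
      ∀ x : E, ‖x‖ ≤ 1 → ∃ y ∈ N, ‖x - y‖ ≤ 1 / 2 := by
  let _ : NormedSpace ℝ E := NormedSpace.restrictScalars ℝ 𝕜 E
  have : IsScalarTower ℝ 𝕜 E := RestrictScalars.isScalarTower ℝ 𝕜 E
  have : FiniteDimensional ℝ E := FiniteDimensional.trans ℝ 𝕜 E
  obtain ⟨N, hN, hN1, hN2⟩ := exists_real_net E
  refine ⟨N, hN.trans ?_, hN1, hN2⟩
  rw [← finrank_mul_finrank ℝ 𝕜 E, show 25 = 5 ^ 2 from rfl, ← pow_mul]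
  exact Nat.pow_le_pow_right (by norm_num)
    (Nat.mul_le_mul_right _ (RCLike.finrank_le_two 𝕜))

variable {𝕜 E F : Type*} [RCLike 𝕜] [NormedAddCommGroup E] [InnerProductSpace 𝕜 E]
  [NormedAddCommGroup F] [InnerProductSpace 𝕜 F]

lemma norm_le_of_net {N : Finset F} (hN : ∀ x : F, ‖x‖ ≤ 1 → ∃ y ∈ N, ‖x - y‖ ≤ 1 / 2) {y : F}
    {m : ℝ} (h : ∀ u ∈ N, RCLike.re (inner 𝕜 u y) ≤ m) : ‖y‖ ≤ 2 * m := by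
  rcases eq_or_ne y 0 with rfl | hy
  · obtain ⟨u, hu, -⟩ := hN 0 (by simp)
    have := h u hu
    simp only [inner_zero_right, map_zero] at this
    simpa using this
  · have hy' : ‖y‖ ≠ 0 := norm_ne_zero_iff.2 hy
    set x : F := ((‖y‖⁻¹ : ℝ) : 𝕜) • y with hx
    have hx1 : ‖x‖ = 1 := by
      rw [hx, norm_smul, RCLike.norm_ofReal, abs_of_nonneg (by positivity), inv_mul_cancel₀ hy']
    have hxy : RCLike.re (inner 𝕜 x y) = ‖y‖ := by
      rw [hx, inner_smul_left, RCLike.conj_ofReal, RCLike.re_ofReal_mul, inner_self_eq_norm_sq]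
      field_simp
    obtain ⟨u, hu, hxu⟩ := hN x hx1.le
    have h1 : RCLike.re (inner 𝕜 (x - u) y) ≤ 1 / 2 * ‖y‖ :=
      (re_inner_le_norm _ _).trans (by gcongr)
    rw [inner_sub_left, map_sub, hxy] at h1
    linarith [h u hu]

/-- Passing to the nearest net point costs at most `‖T‖/2`, so `‖T‖ ≤ 2m + ‖T‖/2`, and the last term
is absorbed. -/
lemma opNorm_le_of_net {N : Finset E} {N' : Finset F}
    (hN : ∀ x : E, ‖x‖ ≤ 1 → ∃ y ∈ N, ‖x - y‖ ≤ 1 / 2)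
    (hN' : ∀ x : F, ‖x‖ ≤ 1 → ∃ y ∈ N', ‖x - y‖ ≤ 1 / 2) (T : E →L[𝕜] F) {m : ℝ}
    (h : ∀ u ∈ N', ∀ w ∈ N, RCLike.re (inner 𝕜 u (T w)) ≤ m) : ‖T‖ ≤ 4 * m := by
  have h2 : ∀ w ∈ N, ‖T w‖ ≤ 2 * m := fun w hw => norm_le_of_net hN' fun u hu => h u hu w hw
  have hm : 0 ≤ 2 * m := by
    obtain ⟨w, hw, -⟩ := hN 0 (by simp)
    exact (norm_nonneg _).trans (h2 w hw)
  have h3 : ‖T‖ ≤ 2 * m + ‖T‖ * (1 / 2) := by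
    let _ : NormedSpace ℝ E := NormedSpace.restrictScalars ℝ 𝕜 E
    refine T.opNorm_le_bound (by positivity) fun x => ?_
    rcases eq_or_ne x 0 with rfl | hx
    · simp
    have hx' : ‖x‖ ≠ 0 := norm_ne_zero_iff.2 hx
    set z : E := ((‖x‖⁻¹ : ℝ) : 𝕜) • x with hz
    have hz1 : ‖z‖ = 1 := by
      rw [hz, norm_smul, RCLike.norm_ofReal, abs_of_nonneg (by positivity), inv_mul_cancel₀ hx']
    have hxz : x = ((‖x‖ : ℝ) : 𝕜) • z := by
      rw [hz, smul_smul, ← RCLike.ofReal_mul, mul_inv_cancel₀ hx', RCLike.ofReal_one, one_smul]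
    obtain ⟨w, hw, hzw⟩ := hN z hz1.le
    have h4 : ‖T z‖ ≤ 2 * m + ‖T‖ * (1 / 2) := by
      have : T z = T w + T (z - w) := by rw [map_sub]; abel
      rw [this]
      refine (norm_add_le _ _).trans (add_le_add (h2 w hw) ?_)
      exact (T.le_opNorm _).trans (by gcongr)
    conv_lhs => rw [hxz, map_smul, norm_smul, RCLike.norm_ofReal, abs_norm]
    rw [mul_comm]
    gcongr
  linarith

end Nets

end SubspaceSVD

namespace SubspaceSVD

/-! ### Moment generating functions and Bernstein's inequality. -/

section Exponential

lemma exp_le_one_add_add_sq_mul_exp_abs (x : ℝ) :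
    Real.exp x ≤ 1 + x + x ^ 2 * Real.exp |x| := by
  have h0 : 1 ≤ Real.exp |x| := Real.one_le_exp (abs_nonneg x)
  have h0' : x ^ 2 ≤ x ^ 2 * Real.exp |x| := le_mul_of_one_le_right (sq_nonneg x) h0
  rcases le_or_gt |x| 1 with h | h
  · have := (abs_le.1 (Real.abs_exp_sub_one_sub_id_le h)).2
    linarith
  · rcases lt_abs.1 h with h | h
    · rw [abs_of_pos (by linarith)]
      have h1 : 1 * Real.exp x ≤ x ^ 2 * Real.exp x := by
        gcongr
        nlinarith
      linarith
    · have : Real.exp x ≤ 1 := Real.exp_le_one_iff.2 (by linarith)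
      nlinarith

/-- For a centred variable the linear term integrates to zero, so only the square-exponential moment
remains. -/
lemma exp_le_id_add_exp_sq (x : ℝ) : Real.exp x ≤ x + Real.exp (x ^ 2) := by
  have h1 := Real.add_one_le_exp (x ^ 2)
  rcases le_or_gt |x| 1 with h | h
  · have := (abs_le.1 (Real.abs_exp_sub_one_sub_id_le h)).2
    linarith
  · rcases lt_abs.1 h with h | h
    · have : Real.exp x ≤ Real.exp (x ^ 2) := Real.exp_le_exp.2 (by nlinarith)
      linarith
    · have : Real.exp x ≤ 1 := Real.exp_le_one_iff.2 (by linarith)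
      nlinarith

lemma exp_mul_le_of_mem_Icc {θ : ℝ} (h0 : 0 ≤ θ) (h1 : θ ≤ 1) (a : ℝ) :
    Real.exp (θ * a) ≤ 1 - θ + θ * Real.exp a := by
  have := convexOn_exp.2 (Set.mem_univ (0 : ℝ)) (Set.mem_univ a) (sub_nonneg.2 h1) h0 (by ring)
  simpa using this

variable {Ω : Type*} [MeasurableSpace Ω] {μ : Measure Ω}

lemma integrable_exp_of_lintegral_le {f : Ω → ℝ} (hf : Measurable f)
    (h : ∫⁻ ω, ENNReal.ofReal (Real.exp (f ω)) ∂μ ≤ 2) :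
    Integrable (fun ω => Real.exp (f ω)) μ ∧ ∫ ω, Real.exp (f ω) ∂μ ≤ 2 := by
  have hm : AEStronglyMeasurable (fun ω => Real.exp (f ω)) μ := hf.exp.aestronglyMeasurable
  have h0 : 0 ≤ᵐ[μ] fun ω => Real.exp (f ω) := ae_of_all _ fun _ => (Real.exp_pos _).le
  refine ⟨⟨hm, ?_⟩, ?_⟩
  · rw [hasFiniteIntegral_iff_ofReal h0]
    exact h.trans_lt (by norm_num)
  · rw [integral_eq_lintegral_of_nonneg_ae h0 hm]
    exact ENNReal.toReal_le_of_le_ofReal (by norm_num) (by simpa using h)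

variable [IsProbabilityMeasure μ]

/-- The target is `e^θ` with `θ = t²L²`. For `θ ≤ 1`, `exp_le_id_add_exp_sq` and convexity give `1 -
θ + 2θ`. For `θ > 1`, Young's inequality `tY ≤ θ/2 + Y²/(2L²)` gives `e^(θ/2) · 3/2`, and `3/2 ≤
e^(θ/2)`. -/
lemma hasSubgaussianMGF_of_lintegral_exp_sq {Y : Ω → ℝ} (hY : Measurable Y) (hYi : Integrable Y μ)
    (hY0 : ∫ ω, Y ω ∂μ = 0) {L : NNReal} (hL : 0 < L)
    (h : ∫⁻ ω, ENNReal.ofReal (Real.exp (Y ω ^ 2 / L ^ 2)) ∂μ ≤ 2) :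
    HasSubgaussianMGF Y (2 * L ^ 2) μ := by
  have hL' : (0 : ℝ) < L := hL
  obtain ⟨hG, hG2⟩ := integrable_exp_of_lintegral_le (hY.pow_const 2 |>.div_const _) h
  set G : Ω → ℝ := fun ω => Real.exp (Y ω ^ 2 / L ^ 2) with hGdef
  have hG0 : ∀ ω, 1 ≤ G ω := fun ω => Real.one_le_exp (by positivity)
  have key : ∀ t ω, Real.exp (t * Y ω) ≤
      Real.exp (t ^ 2 * L ^ 2 / 2) * (1 / 2 + 1 / 2 * G ω) := by
    intro t ω
    have h1 : t * Y ω ≤ t ^ 2 * L ^ 2 / 2 + 1 / 2 * (Y ω ^ 2 / L ^ 2) := by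
      have := sq_nonneg (t * L - Y ω / L)
      have h2 : (t * L - Y ω / L) ^ 2 = t ^ 2 * L ^ 2 - 2 * (t * Y ω) + Y ω ^ 2 / L ^ 2 := by
        field_simp
        ring
      linarith
    have h3 := exp_mul_le_of_mem_Icc (θ := 1 / 2) (by norm_num) (by norm_num) (Y ω ^ 2 / L ^ 2)
    calc Real.exp (t * Y ω) ≤ _ := Real.exp_le_exp.2 h1
      _ = Real.exp (t ^ 2 * L ^ 2 / 2) * Real.exp (1 / 2 * (Y ω ^ 2 / L ^ 2)) := Real.exp_add _ _
      _ ≤ _ := by gcongr; simp only [hGdef]; linarith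
  have hint : ∀ t, Integrable (fun ω => Real.exp (t * Y ω)) μ := by
    intro t
    refine Integrable.mono'
      (((integrable_const (1 / 2 : ℝ)).add (hG.const_mul (1 / 2))).const_mul
        (Real.exp (t ^ 2 * L ^ 2 / 2)))
      (hY.const_mul t).exp.aestronglyMeasurable (ae_of_all _ fun ω => ?_)
    rw [Real.norm_of_nonneg (Real.exp_pos _).le]
    exact key t ω
  refine ⟨hint, fun t => ?_⟩
  have hc : ((2 * L ^ 2 : NNReal) : ℝ) * t ^ 2 / 2 = t ^ 2 * L ^ 2 := by
    push_cast; ring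
  rw [hc, mgf]
  set θ := t ^ 2 * (L : ℝ) ^ 2 with hθ
  have hθ0 : 0 ≤ θ := by positivity
  rcases le_or_gt θ 1 with h1 | h1
  · have hle : ∀ ω, Real.exp (t * Y ω) ≤ t * Y ω + (1 - θ + θ * G ω) := by
      intro ω
      refine (exp_le_id_add_exp_sq _).trans ?_
      have := exp_mul_le_of_mem_Icc hθ0 h1 (Y ω ^ 2 / L ^ 2)
      have h2 : θ * (Y ω ^ 2 / L ^ 2) = (t * Y ω) ^ 2 := by
        rw [hθ]; field_simp
      rw [h2] at this
      gcongr
    have hi2 : Integrable (fun ω => 1 - θ + θ * G ω) μ :=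
      (integrable_const _).add (hG.const_mul θ)
    calc ∫ ω, Real.exp (t * Y ω) ∂μ ≤ ∫ ω, (t * Y ω + (1 - θ + θ * G ω)) ∂μ :=
          integral_mono (hint t) ((hYi.const_mul t).add hi2) hle
      _ = 1 - θ + θ * ∫ ω, G ω ∂μ := by
          rw [integral_add (hYi.const_mul t) hi2, integral_const_mul, hY0,
            integral_add (integrable_const _) (hG.const_mul θ), integral_const_mul]
          simp
      _ ≤ θ + 1 := by nlinarith
      _ ≤ Real.exp θ := Real.add_one_le_exp θ
  · calc ∫ ω, Real.exp (t * Y ω) ∂μ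
        ≤ ∫ ω, Real.exp (θ / 2) * (1 / 2 + 1 / 2 * G ω) ∂μ :=
          integral_mono (hint t)
            (((integrable_const (1 / 2 : ℝ)).add (hG.const_mul (1 / 2))).const_mul _) (key t)
      _ = Real.exp (θ / 2) * (1 / 2 + 1 / 2 * ∫ ω, G ω ∂μ) := by
          rw [integral_const_mul, integral_add (integrable_const _) (hG.const_mul _),
            integral_const_mul]
          simp
      _ ≤ Real.exp (θ / 2) * Real.exp (θ / 2) := by
          have := Real.add_one_le_exp (θ / 2)
          gcongr
          linarith
      _ = Real.exp θ := by rw [← Real.exp_add]; ring_nf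

/-- The moment generating function of a centred subexponential variable near the origin. -/
lemma mgf_sub_integral_le_of_lintegral_exp {ξ : Ω → ℝ} (hξ : Measurable ξ) (hξ0 : ∀ ω, 0 ≤ ξ ω)
    {M : ℝ} (hM : 0 < M) (h : ∫⁻ ω, ENNReal.ofReal (Real.exp (ξ ω / M)) ∂μ ≤ 2) {t : ℝ}
    (ht : |t| * M ≤ 1 / 2) :
    Integrable (fun ω => Real.exp (t * (ξ ω - ∫ ω, ξ ω ∂μ))) μ ∧
      mgf (fun ω => ξ ω - ∫ ω, ξ ω ∂μ) μ t ≤ Real.exp (48 * M ^ 2 * t ^ 2) := by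
  obtain ⟨hG, hG2⟩ := integrable_exp_of_lintegral_le (hξ.div_const _) h
  set G : Ω → ℝ := fun ω => Real.exp (ξ ω / M) with hGdef
  have hξG : ∀ ω, ξ ω ≤ M * (G ω - 1) := by
    intro ω
    have := Real.add_one_le_exp (ξ ω / M)
    have h1 : ξ ω = M * (ξ ω / M) := by field_simp
    have h2 : ξ ω / M ≤ G ω - 1 := by linarith
    calc ξ ω = M * (ξ ω / M) := h1
      _ ≤ _ := by gcongr
  have hGi : Integrable (fun ω => M * (G ω - 1)) μ := (hG.sub (integrable_const 1)).const_mul M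
  have hξi : Integrable ξ μ := by
    refine hGi.mono' hξ.aestronglyMeasurable (ae_of_all _ fun ω => ?_)
    rw [Real.norm_of_nonneg (hξ0 ω)]
    exact hξG ω
  set m := ∫ ω, ξ ω ∂μ with hm
  have hm0 : 0 ≤ m := integral_nonneg hξ0
  have hmM : m ≤ M := by
    have := integral_mono hξi hGi hξG
    rw [integral_const_mul, integral_sub hG (integrable_const 1)] at this
    simp only [integral_const, probReal_univ, smul_eq_mul, mul_one] at this
    nlinarith
  have key : ∀ ω, Real.exp (t * (ξ ω - m)) ≤
      1 + t * (ξ ω - m) + 24 * M ^ 2 * t ^ 2 * G ω := by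
    intro ω
    set a := ξ ω / M with ha
    have ha0 : 0 ≤ a := div_nonneg (hξ0 ω) hM.le
    have hxa : ξ ω = M * a := by rw [ha]; field_simp
    have habs : |ξ ω - m| ≤ M * (a + 1) := by
      rw [abs_le]
      constructor <;> nlinarith
    have h1 : |t * (ξ ω - m)| ≤ 1 / 2 * (a + 1) := by
      rw [abs_mul]
      calc |t| * |ξ ω - m| ≤ |t| * (M * (a + 1)) := by gcongr
        _ = |t| * M * (a + 1) := by ring
        _ ≤ _ := by gcongr
    have h2 : (t * (ξ ω - m)) ^ 2 ≤ t ^ 2 * M ^ 2 * (a + 1) ^ 2 := by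
      rw [mul_pow, mul_assoc, ← mul_pow M]
      gcongr 1
      exact sq_le_sq' (by linarith [(abs_le.1 habs).1]) (abs_le.1 habs).2
    -- From `x²/2 ≤ e^x` at `x = (a + 1)/2`. With `e ≤ 3` in `h4` this gives `24`, and `𝔼 G ≤ 2`
    -- turns it into `48`.
    have h3 : (a + 1) ^ 2 ≤ 8 * Real.exp (1 / 2 * (a + 1)) := by
      have := Real.quadratic_le_exp_of_nonneg (x := 1 / 2 * (a + 1)) (by positivity)
      nlinarith
    have h4 : Real.exp (1 / 2 * (a + 1)) * Real.exp (1 / 2 * (a + 1)) ≤ 3 * G ω := by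
      rw [← Real.exp_add, ← add_mul, show (1 / 2 + 1 / 2 : ℝ) = 1 by norm_num, one_mul, add_comm,
        Real.exp_add]
      have := Real.exp_one_lt_d9
      have := Real.exp_pos a
      simp only [hGdef]
      nlinarith
    refine (exp_le_one_add_add_sq_mul_exp_abs _).trans ?_
    have h5 : (t * (ξ ω - m)) ^ 2 * Real.exp |t * (ξ ω - m)| ≤ 24 * M ^ 2 * t ^ 2 * G ω :=
      calc _ ≤ t ^ 2 * M ^ 2 * (8 * Real.exp (1 / 2 * (a + 1))) * Real.exp (1 / 2 * (a + 1)) := by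
            gcongr
            exact h2.trans (by gcongr)
        _ = t ^ 2 * M ^ 2 * 8 * (Real.exp (1 / 2 * (a + 1)) * Real.exp (1 / 2 * (a + 1))) := by ring
        _ ≤ t ^ 2 * M ^ 2 * 8 * (3 * G ω) := by gcongr
        _ = _ := by ring
    linarith
  have hdi : Integrable (fun ω => ξ ω - m) μ := hξi.sub (integrable_const m)
  have hi1 : Integrable (fun ω => 1 + t * (ξ ω - m)) μ :=
    (integrable_const 1).add (hdi.const_mul t)
  have hi2 : Integrable (fun ω => 24 * M ^ 2 * t ^ 2 * G ω) μ := hG.const_mul _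
  have hint : Integrable (fun ω => Real.exp (t * (ξ ω - m))) μ := by
    refine (hi1.add hi2).mono' (((hξ.sub_const m).const_mul t).exp.aestronglyMeasurable)
      (ae_of_all _ fun ω => ?_)
    rw [Real.norm_of_nonneg (Real.exp_pos _).le]
    exact key ω
  refine ⟨hint, ?_⟩
  calc mgf (fun ω => ξ ω - m) μ t
      ≤ ∫ ω, (1 + t * (ξ ω - m) + 24 * M ^ 2 * t ^ 2 * G ω) ∂μ :=
        integral_mono hint (hi1.add hi2) key
    _ = 1 + 24 * M ^ 2 * t ^ 2 * ∫ ω, G ω ∂μ := by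
        rw [integral_add hi1 hi2, integral_add (integrable_const 1) (hdi.const_mul t),
          integral_const_mul, integral_const_mul, integral_sub hξi (integrable_const m), ← hm]
        simp
    _ ≤ 48 * M ^ 2 * t ^ 2 + 1 := by
        have : 24 * M ^ 2 * t ^ 2 * ∫ ω, G ω ∂μ ≤ 24 * M ^ 2 * t ^ 2 * 2 := by gcongr
        linarith
    _ ≤ _ := Real.add_one_le_exp _

/-- Bernstein's inequality, in a form that involves only the number `n` of summands. -/
lemma measure_abs_sum_sub_integral_ge_le {n : ℕ} (hn : 0 < n) {ξ : Fin n → Ω → ℝ}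
    (hξ : ∀ k, Measurable (ξ k)) (hξ0 : ∀ k ω, 0 ≤ ξ k ω) (hind : iIndepFun ξ μ)
    {M : ℝ} (hM : 1 ≤ M)
    (h : ∀ k, ∫⁻ ω, ENNReal.ofReal (Real.exp (ξ k ω / M)) ∂μ ≤ 2) {q : ℝ} (hq : 0 < q) :
    μ.real {ω | (√(q * n) + q) / 8 ≤ |∑ k, (ξ k ω - ∫ ω, ξ k ω ∂μ)|} ≤
      2 * Real.exp (-(q / (12288 * M ^ 2))) := by
  set s := √(q * n) + q with hs
  have hn' : (0 : ℝ) < n := by exact_mod_cast hn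
  have hsq : 0 < √(q * n) := Real.sqrt_pos.2 (by positivity)
  have hs0 : 0 < s := by positivity
  -- The Chernoff exponent at `l = βq/s` is at most `-βq/8 + 48M²β²q`, because `s² ≥ qn`. This `β`
  -- minimises it, with value `-βq/16 = -q/(12288 M²)`; `s ≥ q` keeps `l` in the range where the
  -- moment bound holds.
  set β := 1 / (768 * M ^ 2) with hβ
  set l := β * q / s with hl
  have hl0 : 0 < l := by positivity
  have hlβ : l ≤ β := by
    rw [hl, div_le_iff₀ hs0]
    gcongr
    linarith
  have hlM : l * M ≤ 1 / 2 := by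
    have h1 : β * M ≤ 1 / 2 := by
      rw [hβ, div_mul_eq_mul_div, div_le_div_iff₀ (by positivity) (by norm_num)]
      nlinarith
    nlinarith
  have hln : n * l ^ 2 ≤ β ^ 2 * q := by
    rw [hl, div_pow, mul_div_assoc', div_le_iff₀ (by positivity)]
    have h1 : q * n ≤ s ^ 2 := by
      rw [hs]
      have := Real.sq_sqrt (show 0 ≤ q * n by positivity)
      nlinarith
    calc n * (β * q) ^ 2 = β ^ 2 * q * (q * n) := by ring
      _ ≤ β ^ 2 * q * s ^ 2 := by gcongr
  set η : Fin n → Ω → ℝ := fun k ω => ξ k ω - ∫ ω, ξ k ω ∂μ with hη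
  have hηm : ∀ k, Measurable (η k) := fun k => (hξ k).sub_const _
  have hηind : iIndepFun η μ :=
    hind.comp (fun k x => x - ∫ ω, ξ k ω ∂μ) fun k => measurable_id.sub_const _
  have hbase : ∀ t : ℝ, |t| = l → Integrable (fun ω => Real.exp (t * (∑ k, η k) ω)) μ ∧
      mgf (∑ k, η k) μ t ≤ Real.exp (β ^ 2 * q * (48 * M ^ 2)) := by
    intro t ht
    have hk := fun k => mgf_sub_integral_le_of_lintegral_exp (hξ k) (hξ0 k)
      (by linarith : 0 < M) (h k) (t := t) (by rw [ht]; exact hlM)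
    refine ⟨?_, ?_⟩
    · exact hηind.integrable_exp_mul_sum hηm fun k _ => (hk k).1
    · rw [hηind.mgf_sum hηm]
      calc ∏ k, mgf (η k) μ t ≤ ∏ _k : Fin n, Real.exp (48 * M ^ 2 * t ^ 2) :=
            Finset.prod_le_prod (fun _ _ => mgf_nonneg) fun k _ => (hk k).2
        _ = Real.exp (n * t ^ 2 * (48 * M ^ 2)) := by
            rw [Finset.prod_const, Finset.card_univ, Fintype.card_fin, ← Real.exp_nat_mul]
            ring_nf
        _ ≤ _ := by
            rw [← sq_abs, ht]
            gcongr
  have hexp : Real.exp (-l * (s / 8)) * Real.exp (β ^ 2 * q * (48 * M ^ 2)) ≤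
      Real.exp (-(q / (12288 * M ^ 2))) := by
    rw [← Real.exp_add]
    refine Real.exp_le_exp.2 (le_of_eq ?_)
    rw [hl, hβ]
    field_simp
    norm_num
  have hsub : {ω | s / 8 ≤ |∑ k, η k ω|} ⊆
      {ω | s / 8 ≤ (∑ k, η k) ω} ∪ {ω | (∑ k, η k) ω ≤ -(s / 8)} := by
    intro ω hω
    have hω' : s / 8 ≤ |(∑ k, η k) ω| := by rw [Finset.sum_apply]; exact hω
    rcases le_abs.1 hω' with h | h
    · exact Or.inl h
    · exact Or.inr (show (∑ k, η k) ω ≤ -(s / 8) by linarith)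
  refine (measureReal_mono hsub).trans ((measureReal_union_le _ _).trans ?_)
  rw [two_mul]
  obtain ⟨hi1, hm1⟩ := hbase l (abs_of_pos hl0)
  obtain ⟨hi2, hm2⟩ := hbase (-l) (by rw [abs_neg, abs_of_pos hl0])
  refine add_le_add ?_ ?_
  · refine (measure_ge_le_exp_mul_mgf _ hl0.le hi1).trans (le_trans ?_ hexp)
    gcongr
  · refine (measure_le_le_exp_mul_mgf _ (by linarith) hi2).trans (le_trans ?_ hexp)
    rw [show - -l * -(s / 8) = -l * (s / 8) by ring]
    gcongr

end Exponential

end SubspaceSVD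

namespace SubspaceSVD

/-! ### Linear functionals of an isotropic subgaussian vector. -/

section RandomVectors

variable {𝕜 : Type*} [RCLike 𝕜] {p : ℕ}

/-- The linear functional `x ↦ zᴴ x` for a vector `z ∈ 𝔽^p`. -/
def rowForm (x : EuclideanSpace 𝕜 (Fin p)) (z : Fin p → 𝕜) : 𝕜 := ∑ j, star (z j) * x j

lemma measurable_rowForm (x : EuclideanSpace 𝕜 (Fin p)) : Measurable (rowForm x) := by
  unfold rowForm
  refine Finset.measurable_sum _ fun j _ => Measurable.mul_const ?_ _
  exact continuous_star.measurable.comp (measurable_pi_apply j)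

lemma rowForm_smul (c : 𝕜) (x : EuclideanSpace 𝕜 (Fin p)) (z : Fin p → 𝕜) :
    rowForm (c • x) z = c * rowForm x z := by
  simp only [rowForm, PiLp.smul_apply, smul_eq_mul, Finset.mul_sum]
  exact Finset.sum_congr rfl fun _ _ => by ring

lemma toEuclideanLin_eq_rowForm {Ω : Type*} {n : ℕ} (Z : Ω → Matrix (Fin n) (Fin p) 𝕜) (ω : Ω)
    (x : EuclideanSpace 𝕜 (Fin p)) (k : Fin n) :
    Matrix.toEuclideanLin (Z ω) x k = rowForm x (rowVec Z k ω) := by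
  simp [rowForm, rowVec, Matrix.ofLp_toLpLin, Matrix.mulVec, dotProduct]

lemma re_rowForm (x : EuclideanSpace 𝕜 (Fin p)) (z : Fin p → 𝕜) :
    RCLike.re (rowForm x z) = (fun i => RCLike.re (z i)) ⬝ᵥ (fun i => RCLike.re (x i)) +
      (fun i => RCLike.im (z i)) ⬝ᵥ (fun i => RCLike.im (x i)) := by
  simp [rowForm, dotProduct, RCLike.mul_re, Finset.sum_add_distrib]

lemma im_rowForm (x : EuclideanSpace 𝕜 (Fin p)) (z : Fin p → 𝕜) :
    RCLike.im (rowForm x z) = (fun i => RCLike.re (z i)) ⬝ᵥ (fun i => RCLike.im (x i)) -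
      (fun i => RCLike.im (z i)) ⬝ᵥ (fun i => RCLike.re (x i)) := by
  simp [rowForm, dotProduct, RCLike.mul_im, Finset.sum_add_distrib, sub_eq_add_neg]

variable {Ω : Type*} [MeasurableSpace Ω] {μ : Measure Ω} {y : Ω → Fin p → 𝕜}

lemma IsIsotropic.memLp_rowForm (h : IsIsotropic y μ) (x : EuclideanSpace 𝕜 (Fin p)) :
    MemLp (fun ω => rowForm x (y ω)) 2 μ := by
  refine memLp_finsetSum _ fun j _ => ?_
  have := (h.1 j).star.const_mul (x j)
  refine this.congr_norm ?_ (ae_of_all _ fun ω => ?_)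
  · exact (this.aestronglyMeasurable).congr (ae_of_all _ fun ω => mul_comm _ _)
  · simp [mul_comm]

/-- Isotropic vectors have second moments `𝔼 |⟨y, x⟩|² = ‖x‖²`. -/
lemma IsIsotropic.integral_norm_sq_rowForm (h : IsIsotropic y μ) (x : EuclideanSpace 𝕜 (Fin p)) :
    ∫ ω, ‖rowForm x (y ω)‖ ^ 2 ∂μ = ‖x‖ ^ 2 := by
  have hint : ∀ i j, Integrable (fun ω => y ω i * star (y ω j)) μ := fun i j =>
    (h.1 i).integrable_mul (h.1 j).star
  have hpt : ∀ ω, ((‖rowForm x (y ω)‖ ^ 2 : ℝ) : 𝕜) =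
      ∑ i, ∑ j, (star (x i) * x j) * (y ω i * star (y ω j)) := by
    intro ω
    rw [RCLike.ofReal_pow, ← RCLike.conj_mul, rowForm, map_sum, Finset.sum_mul_sum]
    refine Finset.sum_congr rfl fun i _ => Finset.sum_congr rfl fun j _ => ?_
    simp
    ring
  have : ((∫ ω, ‖rowForm x (y ω)‖ ^ 2 ∂μ : ℝ) : 𝕜) = ((‖x‖ ^ 2 : ℝ) : 𝕜) := by
    rw [← integral_ofReal]
    simp only [hpt]
    rw [integral_finsetSum _ fun i _ => integrable_finsetSum _ fun j _ =>
      (hint i j).const_mul _]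
    simp_rw [integral_finsetSum _ fun j _ => (hint _ j).const_mul _, integral_const_mul, h.2,
      Matrix.one_apply]
    simp only [mul_ite, mul_one, mul_zero, Finset.sum_ite_eq, Finset.mem_univ, if_true]
    rw [EuclideanSpace.norm_sq_eq, RCLike.ofReal_sum]
    refine Finset.sum_congr rfl fun i _ => ?_
    rw [RCLike.ofReal_pow, ← RCLike.conj_mul]
    rfl
  exact_mod_cast this

lemma IsIsotropic.eLpNorm_rowForm_le (h : IsIsotropic y μ) {x : EuclideanSpace 𝕜 (Fin p)}
    (hx : ‖x‖ ≤ 1) : eLpNorm (fun ω => rowForm x (y ω)) 2 μ ≤ 1 := by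
  rw [(h.memLp_rowForm x).eLpNorm_eq_integral_rpow_norm (by norm_num) (by norm_num)]
  have h1 := h.integral_norm_sq_rowForm x
  simp only [ENNReal.toReal_ofNat, Real.rpow_ofNat, h1]
  rw [← ENNReal.ofReal_one]
  refine ENNReal.ofReal_le_ofReal (Real.rpow_le_one (by positivity) ?_ (by norm_num))
  exact pow_le_one₀ (norm_nonneg _) hx

lemma lintegral_exp_sq_le_of_psiTwoNorm_lt {f : Ω → ℝ} {K : ℝ}
    (h : psiTwoNorm f μ < ENNReal.ofReal K) :
    ∫⁻ ω, ENNReal.ofReal (Real.exp (f ω ^ 2 / K ^ 2)) ∂μ ≤ 2 := by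
  rw [psiTwoNorm, iInf_lt_iff] at h
  obtain ⟨t, ht⟩ := h
  rw [iInf_lt_iff] at ht
  obtain ⟨⟨ht0, ht⟩, htK⟩ := ht
  have htK' : t ≤ K := ((ENNReal.ofReal_lt_ofReal_iff_of_nonneg ht0.le).1 htK).le
  refine (lintegral_mono fun ω => ?_).trans ht
  rw [sq_abs]
  gcongr

/-- Enlarging `τ` to `τ + 1` puts the `ψ₂`-norm strictly below the scale, so an admissible `t` under
it exists even if the infimum is not attained. -/
lemma IsSubgaussianReal.lintegral_exp_sq_le {y : Ω → Fin p → ℝ} {τ : ℝ} (hτ : 0 < τ)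
    (h : IsSubgaussianReal τ y μ) {x : Fin p → ℝ}
    (hx : eLpNorm (fun ω => y ω ⬝ᵥ x) 2 μ ≤ 1) :
    ∫⁻ ω, ENNReal.ofReal (Real.exp ((y ω ⬝ᵥ x) ^ 2 / (τ + 1) ^ 2)) ∂μ ≤ 2 := by
  refine lintegral_exp_sq_le_of_psiTwoNorm_lt ?_
  calc _ ≤ ENNReal.ofReal τ * eLpNorm (fun ω => y ω ⬝ᵥ x) 2 μ := h.2.2 x
    _ ≤ ENNReal.ofReal τ * 1 := by gcongr
    _ < ENNReal.ofReal (τ + 1) := by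
      rw [mul_one]
      exact (ENNReal.ofReal_lt_ofReal_iff (by linarith)).2 (by linarith)

lemma norm_toLp_ofReal_le {x : EuclideanSpace 𝕜 (Fin p)} (hx : ‖x‖ ≤ 1) (f : 𝕜 → ℝ)
    (hf : ∀ a, |f a| ≤ ‖a‖) :
    ‖(WithLp.toLp 2 (fun i => ((f (x i) : ℝ) : 𝕜)) : EuclideanSpace 𝕜 (Fin p))‖ ≤ 1 := by
  refine le_trans ?_ hx
  rw [EuclideanSpace.norm_eq, EuclideanSpace.norm_eq]
  refine Real.sqrt_le_sqrt (Finset.sum_le_sum fun i _ => ?_)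
  rw [RCLike.norm_ofReal]
  gcongr
  exact hf _

/-- Isotropy is applied to the real-valued vector `f(x)`: its functional has `Re y · f(x)` and `Im y
· f(x)` as real and imaginary parts, up to sign. -/
lemma IsIsotropic.eLpNorm_dotProduct_le (h : IsIsotropic y μ) {x : EuclideanSpace 𝕜 (Fin p)}
    (hx : ‖x‖ ≤ 1) (f : 𝕜 → ℝ) (hf : ∀ a, |f a| ≤ ‖a‖) :
    eLpNorm (fun ω => (fun i => RCLike.re (y ω i)) ⬝ᵥ fun i => f (x i)) 2 μ ≤ 1 ∧
    eLpNorm (fun ω => (fun i => RCLike.im (y ω i)) ⬝ᵥ fun i => f (x i)) 2 μ ≤ 1 := by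
  set x' : EuclideanSpace 𝕜 (Fin p) := WithLp.toLp 2 (fun i => ((f (x i) : ℝ) : 𝕜)) with hx'
  have h1 : eLpNorm (fun ω => rowForm x' (y ω)) 2 μ ≤ 1 :=
    h.eLpNorm_rowForm_le (norm_toLp_ofReal_le hx f hf)
  refine ⟨(eLpNorm_mono fun ω => ?_).trans h1, (eLpNorm_mono fun ω => ?_).trans h1⟩
  · have := RCLike.abs_re_le_norm (rowForm x' (y ω))
    rw [re_rowForm] at this
    simpa [hx', dotProduct] using this
  · have := RCLike.abs_im_le_norm (rowForm x' (y ω))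
    rw [im_rowForm] at this
    simpa [hx', dotProduct] using this

lemma exp_quarter_sum_le (a b c d : ℝ) : Real.exp ((a + b + c + d) / 4) ≤
    1 / 4 * (Real.exp a + Real.exp b + Real.exp c + Real.exp d) := by
  have h2 : ∀ u v : ℝ, Real.exp ((u + v) / 2) ≤ 1 / 2 * (Real.exp u + Real.exp v) := by
    intro u v
    have := convexOn_exp.2 (Set.mem_univ u) (Set.mem_univ v) (by norm_num : (0 : ℝ) ≤ 1 / 2)
      (by norm_num : (0 : ℝ) ≤ 1 / 2) (by norm_num)
    simp only [smul_eq_mul] at this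
    rw [show (u + v) / 2 = 1 / 2 * u + 1 / 2 * v by ring]
    linarith
  have h3 := h2 ((a + b) / 2) ((c + d) / 2)
  rw [show ((a + b) / 2 + (c + d) / 2) / 2 = (a + b + c + d) / 4 by ring] at h3
  linarith [h2 a b, h2 c d]

/-- The squared modulus is `(f1 + f4)² + (f2 - f3)²`, at most twice the sum of the four squares.
Division by `8(τ + 1)²` makes the exponent an average of four controlled ones, and convexity of
`exp` finishes; no independence of real and imaginary parts is needed. -/
lemma IsSubgaussian.lintegral_exp_norm_sq_rowForm_le {τ : ℝ} (hτ : 0 < τ)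
    (hy : ∀ i, Measurable fun ω => y ω i)
    (h : IsSubgaussian τ y μ) (hi : IsIsotropic y μ) {x : EuclideanSpace 𝕜 (Fin p)}
    (hx : ‖x‖ ≤ 1) :
    ∫⁻ ω, ENNReal.ofReal (Real.exp (‖rowForm x (y ω)‖ ^ 2 / (8 * (τ + 1) ^ 2))) ∂μ ≤ 2 := by
  set K2 := (τ + 1) ^ 2 with hK2def
  have hK2 : 0 < K2 := by positivity
  set f1 := fun ω => (fun i => RCLike.re (y ω i)) ⬝ᵥ fun i => RCLike.re (x i)
  set f2 := fun ω => (fun i => RCLike.re (y ω i)) ⬝ᵥ fun i => RCLike.im (x i)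
  set f3 := fun ω => (fun i => RCLike.im (y ω i)) ⬝ᵥ fun i => RCLike.re (x i)
  set f4 := fun ω => (fun i => RCLike.im (y ω i)) ⬝ᵥ fun i => RCLike.im (x i)
  obtain ⟨r1, i1⟩ := hi.eLpNorm_dotProduct_le hx RCLike.re RCLike.abs_re_le_norm
  obtain ⟨r2, i2⟩ := hi.eLpNorm_dotProduct_le hx RCLike.im RCLike.abs_im_le_norm
  have a1 : ∫⁻ ω, ENNReal.ofReal (Real.exp (f1 ω ^ 2 / K2)) ∂μ ≤ 2 := h.1.lintegral_exp_sq_le hτ r1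
  have a2 : ∫⁻ ω, ENNReal.ofReal (Real.exp (f2 ω ^ 2 / K2)) ∂μ ≤ 2 := h.1.lintegral_exp_sq_le hτ r2
  have a3 : ∫⁻ ω, ENNReal.ofReal (Real.exp (f3 ω ^ 2 / K2)) ∂μ ≤ 2 := h.2.lintegral_exp_sq_le hτ i1
  have a4 : ∫⁻ ω, ENNReal.ofReal (Real.exp (f4 ω ^ 2 / K2)) ∂μ ≤ 2 := h.2.lintegral_exp_sq_le hτ i2
  have hre : ∀ i, Measurable fun ω => RCLike.re (y ω i) := fun i => RCLike.measurable_re.comp (hy i)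
  have him : ∀ i, Measurable fun ω => RCLike.im (y ω i) := fun i => RCLike.measurable_im.comp (hy i)
  have hmeas : ∀ (g : Ω → Fin p → ℝ) (c : Fin p → ℝ), (∀ i, Measurable fun ω => g ω i) →
      Measurable fun ω => ENNReal.ofReal (Real.exp ((g ω ⬝ᵥ c) ^ 2 / (τ + 1) ^ 2)) := by
    intro g c hg
    have : Measurable fun ω => g ω ⬝ᵥ c :=
      Finset.measurable_sum _ fun i _ => (hg i).mul_const _
    exact ((this.pow_const 2).div_const _).exp.ennreal_ofReal
  have m1 : Measurable fun ω => ENNReal.ofReal (Real.exp (f1 ω ^ 2 / K2)) :=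
    hmeas _ (fun i => RCLike.re (x i)) hre
  have m2 : Measurable fun ω => ENNReal.ofReal (Real.exp (f2 ω ^ 2 / K2)) :=
    hmeas _ (fun i => RCLike.im (x i)) hre
  have m3 : Measurable fun ω => ENNReal.ofReal (Real.exp (f3 ω ^ 2 / K2)) :=
    hmeas _ (fun i => RCLike.re (x i)) him
  have m4 : Measurable fun ω => ENNReal.ofReal (Real.exp (f4 ω ^ 2 / K2)) :=
    hmeas _ (fun i => RCLike.im (x i)) him
  have hpt : ∀ ω, ENNReal.ofReal (Real.exp (‖rowForm x (y ω)‖ ^ 2 / (8 * K2))) ≤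
      ENNReal.ofReal (1 / 4) * (ENNReal.ofReal (Real.exp (f1 ω ^ 2 / K2)) +
        ENNReal.ofReal (Real.exp (f2 ω ^ 2 / K2)) + ENNReal.ofReal (Real.exp (f3 ω ^ 2 / K2)) +
        ENNReal.ofReal (Real.exp (f4 ω ^ 2 / K2))) := by
    intro ω
    rw [← ENNReal.ofReal_add (by positivity) (by positivity),
      ← ENNReal.ofReal_add (by positivity) (by positivity),
      ← ENNReal.ofReal_add (by positivity) (by positivity), ← ENNReal.ofReal_mul (by norm_num)]
    refine ENNReal.ofReal_le_ofReal (le_trans ?_ (exp_quarter_sum_le _ _ _ _))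
    refine Real.exp_le_exp.2 ?_
    have h1 : ‖rowForm x (y ω)‖ ^ 2 = (f1 ω + f4 ω) ^ 2 + (f2 ω - f3 ω) ^ 2 := by
      rw [RCLike.norm_sq_eq_def, re_rowForm, im_rowForm]
      simp only [f1, f2, f3, f4]
      ring
    rw [h1, div_le_iff₀ (by positivity)]
    have : (f1 ω ^ 2 / K2 + f2 ω ^ 2 / K2 + f3 ω ^ 2 / K2 + f4 ω ^ 2 / K2) / 4 * (8 * K2) =
        2 * (f1 ω ^ 2 + f2 ω ^ 2 + f3 ω ^ 2 + f4 ω ^ 2) := by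
      field_simp
      ring
    rw [this]
    nlinarith [sq_nonneg (f1 ω - f4 ω), sq_nonneg (f2 ω + f3 ω)]
  refine (lintegral_mono hpt).trans ?_
  rw [lintegral_const_mul' _ _ ENNReal.ofReal_ne_top, lintegral_add_right _ m4,
    lintegral_add_right _ m3, lintegral_add_right _ m2]
  calc _ ≤ ENNReal.ofReal (1 / 4) * (2 + 2 + 2 + 2) := by gcongr
    _ = 2 := by
      rw [show (2 + 2 + 2 + 2 : ℝ≥0∞) = ENNReal.ofReal 8 by norm_num,
        ← ENNReal.ofReal_mul (by norm_num)]
      norm_num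

lemma IsSubgaussian.integral_re_rowForm {τ : ℝ} [IsFiniteMeasure μ] (h : IsSubgaussian τ y μ)
    (x : EuclideanSpace 𝕜 (Fin p)) : ∫ ω, RCLike.re (rowForm x (y ω)) ∂μ = 0 := by
  have h1 : ∀ i, Integrable (fun ω => RCLike.re (y ω i) * RCLike.re (x i)) μ := fun i =>
    ((h.1.1 i).integrable (by norm_num)).mul_const _
  have h2 : ∀ i, Integrable (fun ω => RCLike.im (y ω i) * RCLike.im (x i)) μ := fun i =>
    ((h.2.1 i).integrable (by norm_num)).mul_const _
  simp only [re_rowForm, dotProduct]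
  rw [integral_add (integrable_finsetSum _ fun i _ => h1 i)
    (integrable_finsetSum _ fun i _ => h2 i), integral_finsetSum _ fun i _ => h1 i,
    integral_finsetSum _ fun i _ => h2 i]
  simp [integral_mul_const, h.1.2.1, h.2.2.1]

/-- Linear functionals of an isotropic subgaussian vector are subgaussian. -/
lemma IsSubgaussian.hasSubgaussianMGF_re_rowForm [IsProbabilityMeasure μ] {τ : ℝ} (hτ : 0 < τ)
    (hy : ∀ i, Measurable fun ω => y ω i)
    (h : IsSubgaussian τ y μ) (hi : IsIsotropic y μ) (x : EuclideanSpace 𝕜 (Fin p)) :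
    HasSubgaussianMGF (fun ω => RCLike.re (rowForm x (y ω)))
      (Real.toNNReal (16 * (τ + 1) ^ 2 * ‖x‖ ^ 2)) μ := by
  have hone : ∀ x : EuclideanSpace 𝕜 (Fin p), ‖x‖ ≤ 1 →
      HasSubgaussianMGF (fun ω => RCLike.re (rowForm x (y ω)))
        (2 * (Real.toNNReal (√8 * (τ + 1))) ^ 2) μ := by
    intro x hx
    refine hasSubgaussianMGF_of_lintegral_exp_sq ?_ ?_ (h.integral_re_rowForm x)
      (Real.toNNReal_pos.2 (by positivity)) ?_
    · exact RCLike.measurable_re.comp ((measurable_rowForm x).comp (measurable_pi_iff.2 hy))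
    · exact ((hi.memLp_rowForm x).integrable (by norm_num)).re
    · rw [Real.coe_toNNReal _ (by positivity), mul_pow, Real.sq_sqrt (by norm_num)]
      refine (lintegral_mono fun ω => ?_).trans (h.lintegral_exp_norm_sq_rowForm_le hτ hy hi hx)
      refine ENNReal.ofReal_le_ofReal (Real.exp_le_exp.2 ?_)
      gcongr ?_ / _
      rw [← sq_abs]
      gcongr
      exact RCLike.abs_re_le_norm _
  rcases eq_or_ne x 0 with rfl | hx
  · have : (fun ω => RCLike.re (rowForm (0 : EuclideanSpace 𝕜 (Fin p)) (y ω))) = fun _ => 0 := by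
      funext ω
      simp [rowForm]
    rw [this]
    simp
  · have hx' : ‖x‖ ≠ 0 := norm_ne_zero_iff.2 hx
    set z : EuclideanSpace 𝕜 (Fin p) := ((‖x‖⁻¹ : ℝ) : 𝕜) • x with hz
    have hz1 : ‖z‖ = 1 := by
      rw [hz, norm_smul, RCLike.norm_ofReal, abs_of_nonneg (by positivity), inv_mul_cancel₀ hx']
    have hxz : x = ((‖x‖ : ℝ) : 𝕜) • z := by
      rw [hz, smul_smul, ← RCLike.ofReal_mul, mul_inv_cancel₀ hx', RCLike.ofReal_one, one_smul]
    have h1 := (hone z hz1.le).const_mul ‖x‖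
    convert! h1 using 1
    · funext ω
      conv_lhs => rw [hxz, rowForm_smul, RCLike.re_ofReal_mul]
    · refine NNReal.eq ?_
      rw [Real.coe_toNNReal _ (by positivity)]
      change _ = ‖x‖ ^ 2 * ((2 * Real.toNNReal (√8 * (τ + 1)) ^ 2 : NNReal) : ℝ)
      push_cast
      rw [Real.coe_toNNReal _ (by positivity), mul_pow, Real.sq_sqrt (by norm_num)]
      ring

end RandomVectors

end SubspaceSVD

namespace SubspaceSVD

open Module

/-! ### Tail bounds for the noise matrix at fixed vectors. -/

section RandomMatrix

variable {𝕜 : Type*} [RCLike 𝕜] {Ω : Type*} {n p : ℕ} {Z : Ω → Matrix (Fin n) (Fin p) 𝕜}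

lemma re_inner_toEuclideanLin_eq_sum (u : EuclideanSpace 𝕜 (Fin n))
    (w : EuclideanSpace 𝕜 (Fin p)) (ω : Ω) :
    RCLike.re (inner 𝕜 u (Matrix.toEuclideanLin (Z ω) w)) =
      ∑ k, RCLike.re (rowForm (star (u k) • w) (rowVec Z k ω)) := by
  simp only [PiLp.inner_apply, map_sum, toEuclideanLin_eq_rowForm, rowForm_smul,
    RCLike.inner_apply, RCLike.star_def]
  exact Finset.sum_congr rfl fun _ _ => by rw [mul_comm]

lemma norm_sq_toEuclideanLin_eq_sum (w : EuclideanSpace 𝕜 (Fin p)) (ω : Ω) :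
    ‖Matrix.toEuclideanLin (Z ω) w‖ ^ 2 = ∑ k, ‖rowForm w (rowVec Z k ω)‖ ^ 2 := by
  simp only [EuclideanSpace.norm_sq_eq, toEuclideanLin_eq_rowForm]

variable [MeasurableSpace Ω] {μ : Measure Ω} {τ q : ℝ}

lemma measurable_rowVec (hZ : ∀ i j, Measurable fun ω => Z ω i j) (k : Fin n) :
    Measurable (rowVec Z k) :=
  measurable_pi_iff.2 fun j => continuous_star.measurable.comp (hZ k j)

lemma measurable_re_inner_toEuclideanLin (hZ : ∀ i j, Measurable fun ω => Z ω i j)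
    (u : EuclideanSpace 𝕜 (Fin n)) (w : EuclideanSpace 𝕜 (Fin p)) :
    Measurable fun ω => RCLike.re (inner 𝕜 u (Matrix.toEuclideanLin (Z ω) w)) := by
  simp only [re_inner_toEuclideanLin_eq_sum]
  exact Finset.measurable_sum _ fun k _ =>
    RCLike.measurable_re.comp ((measurable_rowForm _).comp (measurable_rowVec hZ k))

lemma measurable_norm_sq_toEuclideanLin (hZ : ∀ i j, Measurable fun ω => Z ω i j)
    (w : EuclideanSpace 𝕜 (Fin p)) :
    Measurable fun ω => ‖Matrix.toEuclideanLin (Z ω) w‖ ^ 2 := by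
  simp only [norm_sq_toEuclideanLin_eq_sum]
  exact Finset.measurable_sum _ fun k _ =>
    ((measurable_rowForm _).comp (measurable_rowVec hZ k)).norm.pow_const 2

variable [IsProbabilityMeasure μ]

lemma measure_re_inner_toEuclideanLin_ge_le (hτ : 0 < τ)
    (hZ : ∀ i j, Measurable fun ω => Z ω i j)
    (hind : iIndepFun (fun k => rowVec Z k) μ) (hiso : ∀ k, IsIsotropic (rowVec Z k) μ)
    (hsub : ∀ k, IsSubgaussian τ (rowVec Z k) μ) (hq : 0 < q) {u : EuclideanSpace 𝕜 (Fin n)}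
    {w : EuclideanSpace 𝕜 (Fin p)} (hu : ‖u‖ ≤ 1) (hw : ‖w‖ ≤ 1) :
    μ.real {ω | √q / 4 ≤ RCLike.re (inner 𝕜 u (Matrix.toEuclideanLin (Z ω) w))} ≤
      Real.exp (-(q / (12288 * (8 * (τ + 1) ^ 2) ^ 2))) := by
  set M := 8 * (τ + 1) ^ 2 with hM
  have hM1 : 1 ≤ M := by nlinarith
  simp only [re_inner_toEuclideanLin_eq_sum]
  have hind' : iIndepFun (fun k ω => RCLike.re (rowForm (star (u k) • w) (rowVec Z k ω))) μ :=
    hind.comp (fun k z => RCLike.re (rowForm (star (u k) • w) z)) fun k =>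
      RCLike.measurable_re.comp (measurable_rowForm _)
  have h1 := HasSubgaussianMGF.sum_of_iIndepFun hind' (s := Finset.univ) fun k _ =>
    (hsub k).hasSubgaussianMGF_re_rowForm hτ
      (fun j => (measurable_pi_apply j).comp (measurable_rowVec hZ k)) (hiso k) (star (u k) • w)
  have hc : ((∑ k, Real.toNNReal (16 * (τ + 1) ^ 2 * ‖star (u k) • w‖ ^ 2) : NNReal) : ℝ) ≤
      2 * M := by
    push_cast
    calc _ = 16 * (τ + 1) ^ 2 * (‖u‖ ^ 2 * ‖w‖ ^ 2) := by
          rw [EuclideanSpace.norm_sq_eq u, Finset.sum_mul, Finset.mul_sum]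
          refine Finset.sum_congr rfl fun k _ => ?_
          rw [Real.coe_toNNReal _ (by positivity), norm_smul, norm_star, mul_pow]
      _ ≤ 16 * (τ + 1) ^ 2 * (1 * 1) := by
          gcongr
          · exact pow_le_one₀ (norm_nonneg _) hu
          · exact pow_le_one₀ (norm_nonneg _) hw
      _ = 2 * M := by rw [hM]; ring
  have hM0 : 0 ≤ 2 * M := by positivity
  have h2 : HasSubgaussianMGF
      (fun ω => ∑ k, RCLike.re (rowForm (star (u k) • w) (rowVec Z k ω))) (2 * M).toNNReal μ := by
    refine ⟨h1.integrable_exp_mul, fun t => (h1.mgf_le t).trans (Real.exp_le_exp.2 ?_)⟩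
    gcongr
    rwa [← NNReal.coe_le_coe, Real.coe_toNNReal _ hM0]
  -- The true rate is `q/(64M)`; it is weakened to the Bernstein rate so that one exponential serves
  -- the whole union bound.
  refine (h2.measure_ge_le (by positivity)).trans (Real.exp_le_exp.2 ?_)
  rw [Real.coe_toNNReal _ hM0, div_pow, Real.sq_sqrt hq.le, neg_div, neg_le_neg_iff, div_div]
  exact div_le_div_of_nonneg_left hq.le (by positivity) (by nlinarith)

lemma measure_abs_norm_sq_toEuclideanLin_sub_ge_le (hn : 0 < n) (hτ : 0 < τ)
    (hZ : ∀ i j, Measurable fun ω => Z ω i j)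
    (hind : iIndepFun (fun k => rowVec Z k) μ) (hiso : ∀ k, IsIsotropic (rowVec Z k) μ)
    (hsub : ∀ k, IsSubgaussian τ (rowVec Z k) μ) (hq : 0 < q)
    {x : EuclideanSpace 𝕜 (Fin p)} (hx : ‖x‖ ≤ 1) :
    μ.real {ω | (√(q * n) + q) / 8 ≤ |‖Matrix.toEuclideanLin (Z ω) x‖ ^ 2 - n * ‖x‖ ^ 2|} ≤
      2 * Real.exp (-(q / (12288 * (8 * (τ + 1) ^ 2) ^ 2))) := by
  have h := measure_abs_sum_sub_integral_ge_le (μ := μ) hn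
    (ξ := fun k ω => ‖rowForm x (rowVec Z k ω)‖ ^ 2) (M := 8 * (τ + 1) ^ 2) (q := q)
    (fun k => ((measurable_rowForm _).comp (measurable_rowVec hZ k)).norm.pow_const 2)
    (fun k ω => by positivity)
    (hind.comp (fun k z => ‖rowForm x z‖ ^ 2) fun k => (measurable_rowForm _).norm.pow_const 2)
    (by nlinarith)
    (fun k => (hsub k).lintegral_exp_norm_sq_rowForm_le hτ
      (fun j => (measurable_pi_apply j).comp (measurable_rowVec hZ k)) (hiso k) hx) hq
  simp only [(hiso _).integral_norm_sq_rowForm, Finset.sum_sub_distrib,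
    ← norm_sq_toEuclideanLin_eq_sum, Finset.sum_const, Finset.card_univ, Fintype.card_fin,
    nsmul_eq_mul] at h
  exact h

end RandomMatrix

/-! ### From nets to uniform bounds on bilinear forms. -/

section Deterministic

variable {𝕜 E F : Type*} [RCLike 𝕜] [NormedAddCommGroup E] [InnerProductSpace 𝕜 E]
  [NormedAddCommGroup F] [InnerProductSpace 𝕜 F]

/-- Polarization. -/
lemma re_inner_eq_norm_sq_sub_norm_sq (x y : E) :
    RCLike.re (inner 𝕜 x y) =
      ‖((1 / 2 : ℝ) : 𝕜) • (x + y)‖ ^ 2 - ‖((1 / 2 : ℝ) : 𝕜) • (x - y)‖ ^ 2 := by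
  rw [norm_smul, norm_smul, mul_pow, mul_pow, @norm_add_sq 𝕜, @norm_sub_sq 𝕜, RCLike.norm_ofReal]
  norm_num
  ring

variable [FiniteDimensional 𝕜 E] [FiniteDimensional 𝕜 F]

/-- Projecting `L` onto `K` gives an operator with values in `K`, so a net of `K` suffices in place
of one of `F`. -/
lemma abs_re_inner_le_of_net_of_mem {K : Submodule 𝕜 F} {N : Finset E} {N' : Finset K}
    (hN : ∀ x : E, ‖x‖ ≤ 1 → ∃ y ∈ N, ‖x - y‖ ≤ 1 / 2)
    (hN' : ∀ x : K, ‖x‖ ≤ 1 → ∃ y ∈ N', ‖x - y‖ ≤ 1 / 2) (L : E →ₗ[𝕜] F) {m : ℝ}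
    (h : ∀ u ∈ N', ∀ w ∈ N, RCLike.re (inner 𝕜 (u : F) (L w)) ≤ m) {u : F} (hu : u ∈ K) (w : E) :
    |RCLike.re (inner 𝕜 u (L w))| ≤ 4 * m * ‖u‖ * ‖w‖ := by
  let T : E →L[𝕜] K := K.orthogonalProjectionOnto ∘L LinearMap.toContinuousLinearMap L
  have hT : ∀ (u : K) (w : E), inner 𝕜 u (T w) = inner 𝕜 (u : F) (L w) := fun u w =>
    Submodule.inner_orthogonalProjectionOnto_eq_of_mem_left u (L w)
  have hTn : ‖T‖ ≤ 4 * m := opNorm_le_of_net hN hN' T fun u hu w hw => by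
    rw [hT]
    exact h u hu w hw
  rw [← hT ⟨u, hu⟩ w]
  calc _ ≤ ‖inner 𝕜 (⟨u, hu⟩ : K) (T w)‖ := RCLike.abs_re_le_norm _
    _ ≤ ‖u‖ * ‖T w‖ := norm_inner_le_norm _ _
    _ ≤ ‖u‖ * (‖T‖ * ‖w‖) := by gcongr; exact T.le_opNorm w
    _ ≤ ‖u‖ * (4 * m * ‖w‖) := by gcongr
    _ = _ := by ring

/-- The form is that of `L* L - c`; polarization bounds it by `2t` on pairs of net points, and the
net argument costs a factor `4`. -/
lemma abs_re_inner_sub_le_of_net {N : Finset E}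
    (hN : ∀ x : E, ‖x‖ ≤ 1 → ∃ y ∈ N, ‖x - y‖ ≤ 1 / 2) (L : E →ₗ[𝕜] F) {c t : ℝ}
    (h : ∀ u ∈ N, ∀ w ∈ N,
      |‖L (((1 / 2 : ℝ) : 𝕜) • (u + w))‖ ^ 2 - c * ‖((1 / 2 : ℝ) : 𝕜) • (u + w)‖ ^ 2| ≤ t ∧
      |‖L (((1 / 2 : ℝ) : 𝕜) • (u - w))‖ ^ 2 - c * ‖((1 / 2 : ℝ) : 𝕜) • (u - w)‖ ^ 2| ≤ t)
    (x y : E) :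
    |RCLike.re (inner 𝕜 (L x) (L y)) - c * RCLike.re (inner 𝕜 x y)| ≤ 8 * t * ‖x‖ * ‖y‖ := by
  let T : E →L[𝕜] E := LinearMap.toContinuousLinearMap
    (LinearMap.adjoint L ∘ₗ L - (c : 𝕜) • LinearMap.id)
  have hT : ∀ u w, RCLike.re (inner 𝕜 u (T w)) =
      RCLike.re (inner 𝕜 (L u) (L w)) - c * RCLike.re (inner 𝕜 u w) := by
    intro u w
    have : T w = LinearMap.adjoint L (L w) - (c : 𝕜) • w := rfl
    rw [this, inner_sub_right, LinearMap.adjoint_inner_right, inner_smul_right, map_sub,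
      RCLike.re_ofReal_mul]
  have hTn : ‖T‖ ≤ 4 * (2 * t) := opNorm_le_of_net hN hN T fun u hu w hw => by
    obtain ⟨h1, h2⟩ := h u hu w hw
    rw [hT, re_inner_eq_norm_sq_sub_norm_sq (L u), re_inner_eq_norm_sq_sub_norm_sq u, ← map_add,
      ← map_sub, ← map_smul, ← map_smul]
    linarith [(abs_le.1 h1).2, (abs_le.1 h2).1]
  rw [← hT]
  calc _ ≤ ‖inner 𝕜 x (T y)‖ := RCLike.abs_re_le_norm _
    _ ≤ ‖x‖ * ‖T y‖ := norm_inner_le_norm _ _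
    _ ≤ ‖x‖ * (‖T‖ * ‖y‖) := by gcongr; exact T.le_opNorm y
    _ ≤ ‖x‖ * (4 * (2 * t) * ‖y‖) := by gcongr
    _ = _ := by ring

end Deterministic

/-! ### The good event. -/

section Event

variable {𝕜 : Type*} [RCLike 𝕜] {Ω : Type*} [MeasurableSpace Ω] {μ : Measure Ω}
  [IsProbabilityMeasure μ] {n p : ℕ} {Z : Ω → Matrix (Fin n) (Fin p) 𝕜} {τ q : ℝ}

/-- With high probability the noise is nearly orthogonal to a fixed subspace of dimension at most
`p` and `Zᴴ Z` is close to `n I`. -/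
lemma exists_event (hn : 0 < n) (hτ : 0 < τ) (hZ : ∀ i j, Measurable fun ω => Z ω i j)
    (hind : iIndepFun (fun k => rowVec Z k) μ) (hiso : ∀ k, IsIsotropic (rowVec Z k) μ)
    (hsub : ∀ k, IsSubgaussian τ (rowVec Z k) μ) (hq : 0 < q)
    (K : Submodule 𝕜 (EuclideanSpace 𝕜 (Fin n))) (hK : finrank 𝕜 K ≤ p) :
    ∃ A : Set Ω, MeasurableSet A ∧
      1 - 5 * 25 ^ (2 * p) * Real.exp (-(q / (12288 * (8 * (τ + 1) ^ 2) ^ 2))) ≤ μ.real A ∧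
      ∀ ω ∈ A,
        (∀ u ∈ K, ∀ w, |RCLike.re (inner 𝕜 u (Matrix.toEuclideanLin (Z ω) w))| ≤
          √q * ‖u‖ * ‖w‖) ∧
        ∀ x y, |RCLike.re (inner 𝕜 (Matrix.toEuclideanLin (Z ω) x)
          (Matrix.toEuclideanLin (Z ω) y)) - n * RCLike.re (inner 𝕜 x y)| ≤
            (√(q * n) + q) * ‖x‖ * ‖y‖ := by
  obtain ⟨N, hNc, hN1, hN⟩ := exists_net 𝕜 (EuclideanSpace 𝕜 (Fin p))
  obtain ⟨N', hNc', hN1', hN'⟩ := exists_net 𝕜 K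
  rw [finrank_euclideanSpace_fin] at hNc
  set e := Real.exp (-(q / (12288 * (8 * (τ + 1) ^ 2) ^ 2))) with he
  have he0 : 0 < e := Real.exp_pos _
  let B₁ : K × EuclideanSpace 𝕜 (Fin p) → Set Ω := fun a =>
    {ω | √q / 4 ≤ RCLike.re (inner 𝕜 (a.1 : EuclideanSpace 𝕜 (Fin n))
      (Matrix.toEuclideanLin (Z ω) a.2))}
  let B₂ : EuclideanSpace 𝕜 (Fin p) → Set Ω := fun x =>
    {ω | (√(q * n) + q) / 8 ≤ |‖Matrix.toEuclideanLin (Z ω) x‖ ^ 2 - n * ‖x‖ ^ 2|}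
  have hB₁m : ∀ a, MeasurableSet (B₁ a) := fun a =>
    measurableSet_le measurable_const (measurable_re_inner_toEuclideanLin hZ _ _)
  have hB₂m : ∀ x, MeasurableSet (B₂ x) := fun x => measurableSet_le measurable_const
    (((measurable_norm_sq_toEuclideanLin hZ x).sub_const _).abs)
  let s : EuclideanSpace 𝕜 (Fin p) × EuclideanSpace 𝕜 (Fin p) → EuclideanSpace 𝕜 (Fin p) :=
    fun a => ((1 / 2 : ℝ) : 𝕜) • (a.1 + a.2)
  let d : EuclideanSpace 𝕜 (Fin p) × EuclideanSpace 𝕜 (Fin p) → EuclideanSpace 𝕜 (Fin p) :=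
    fun a => ((1 / 2 : ℝ) : 𝕜) • (a.1 - a.2)
  -- Each pair of net points costs one tail `e` for the cross term, and two two-sided tails, `4e`,
  -- for the half-sum and half-difference in the polarization: in all the factor `5`.
  let D : Set Ω := (⋃ a ∈ N' ×ˢ N, B₁ a) ∪ ⋃ a ∈ N ×ˢ N, (B₂ (s a) ∪ B₂ (d a))
  have hDm : MeasurableSet D := by
    refine MeasurableSet.union ?_ ?_
    · exact Finset.measurableSet_biUnion _ fun a _ => hB₁m a
    · exact Finset.measurableSet_biUnion _ fun a _ => (hB₂m _).union (hB₂m _)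
  have hhalf : ∀ x : EuclideanSpace 𝕜 (Fin p), ‖x‖ ≤ 2 → ‖((1 / 2 : ℝ) : 𝕜) • x‖ ≤ 1 := by
    intro x hx
    rw [norm_smul, RCLike.norm_ofReal, abs_of_pos (by norm_num)]
    linarith
  have hD : μ.real D ≤ 5 * 25 ^ (2 * p) * e := by
    have h1 : μ.real (⋃ a ∈ N' ×ˢ N, B₁ a) ≤ 25 ^ (2 * p) * e := by
      refine (measureReal_biUnion_finset_le _ _).trans ?_
      calc ∑ a ∈ N' ×ˢ N, μ.real (B₁ a) ≤ ∑ _a ∈ N' ×ˢ N, e := by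
            refine Finset.sum_le_sum fun a ha => ?_
            obtain ⟨ha1, ha2⟩ := Finset.mem_product.1 ha
            exact measure_re_inner_toEuclideanLin_ge_le hτ hZ hind hiso hsub hq (hN1' _ ha1)
              (hN1 _ ha2)
        _ = ((N'.card * N.card : ℕ) : ℝ) * e := by
            rw [Finset.sum_const, Finset.card_product, nsmul_eq_mul]
        _ ≤ ((25 ^ (2 * p) : ℕ) : ℝ) * e := by
            gcongr
            rw [two_mul, pow_add]
            exact Nat.mul_le_mul (hNc'.trans (Nat.pow_le_pow_right (by norm_num) hK)) hNc
        _ = _ := by push_cast; rfl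
    have h2 : μ.real (⋃ a ∈ N ×ˢ N, (B₂ (s a) ∪ B₂ (d a))) ≤ 25 ^ (2 * p) * (4 * e) := by
      refine (measureReal_biUnion_finset_le _ _).trans ?_
      calc ∑ a ∈ N ×ˢ N, μ.real (B₂ (s a) ∪ B₂ (d a)) ≤ ∑ _a ∈ N ×ˢ N, 4 * e := by
            refine Finset.sum_le_sum fun a ha => ?_
            obtain ⟨ha1, ha2⟩ := Finset.mem_product.1 ha
            have hs : ‖a.1 + a.2‖ ≤ 2 :=
              (norm_add_le _ _).trans (by linarith [hN1 _ ha1, hN1 _ ha2])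
            have hd : ‖a.1 - a.2‖ ≤ 2 :=
              (norm_sub_le _ _).trans (by linarith [hN1 _ ha1, hN1 _ ha2])
            have k1 := measure_abs_norm_sq_toEuclideanLin_sub_ge_le hn hτ hZ hind hiso hsub hq
              (hhalf _ hs)
            have k2 := measure_abs_norm_sq_toEuclideanLin_sub_ge_le hn hτ hZ hind hiso hsub hq
              (hhalf _ hd)
            refine (measureReal_union_le _ _).trans ((add_le_add k1 k2).trans (le_of_eq ?_))
            ring
        _ = ((N.card * N.card : ℕ) : ℝ) * (4 * e) := by
            rw [Finset.sum_const, Finset.card_product, nsmul_eq_mul]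
        _ ≤ ((25 ^ (2 * p) : ℕ) : ℝ) * (4 * e) := by
            gcongr
            rw [two_mul, pow_add]
            exact Nat.mul_le_mul hNc hNc
        _ = _ := by push_cast; rfl
    refine (measureReal_union_le _ _).trans ((add_le_add h1 h2).trans (le_of_eq ?_))
    ring
  refine ⟨Dᶜ, hDm.compl, ?_, fun ω hω => ?_⟩
  · rw [probReal_compl_eq_one_sub hDm]
    linarith
  · have hω1 : ∀ u ∈ N', ∀ w ∈ N, RCLike.re (inner 𝕜 (u : EuclideanSpace 𝕜 (Fin n))
        (Matrix.toEuclideanLin (Z ω) w)) ≤ √q / 4 := by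
      intro u hu w hw
      by_contra! hcon
      exact hω (Or.inl (Set.mem_biUnion (x := (u, w)) (Finset.mem_product.2 ⟨hu, hw⟩) hcon.le))
    have hω2 : ∀ u ∈ N, ∀ w ∈ N, ω ∉ B₂ (s (u, w)) ∪ B₂ (d (u, w)) := by
      intro u hu w hw hcon
      exact hω (Or.inr (Set.mem_biUnion (x := (u, w)) (Finset.mem_product.2 ⟨hu, hw⟩) hcon))
    refine ⟨fun u hu w => ?_, fun x y => ?_⟩
    · refine (abs_re_inner_le_of_net_of_mem hN hN' _ hω1 hu w).trans (le_of_eq ?_)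
      ring
    · refine (abs_re_inner_sub_le_of_net hN _ (t := (√(q * n) + q) / 8) (fun u hu w hw => ?_)
        x y).trans (le_of_eq ?_)
      · have := hω2 u hu w hw
        rw [Set.mem_union, not_or] at this
        exact ⟨(not_le.1 this.1).le, (not_le.1 this.2).le⟩
      · ring

end Event

end SubspaceSVD

namespace SubspaceSVD

open Module

/-! ### Constants. -/

section Numerics

/-- The prefactor is `5^(4p+1) ≤ 5^(5p) ≤ e^(10p)`, as `5 ≤ e²`, so it uses up at most half of the
exponent `x ≥ 20p`. -/
lemma five_mul_pow_mul_exp_le {p : ℕ} (hp : 1 ≤ p) {x : ℝ} (hx : 20 * p ≤ x) :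
    5 * 25 ^ (2 * p) * Real.exp (-x) ≤ Real.exp (-(x / 2)) := by
  have h5 : (5 : ℝ) ≤ Real.exp 1 ^ 2 := by
    have := Real.exp_one_gt_d9
    nlinarith
  have h1 : (5 : ℝ) * 25 ^ (2 * p) ≤ Real.exp (10 * p) := by
    calc (5 : ℝ) * 25 ^ (2 * p) = 5 ^ (4 * p + 1) := by
          rw [show (25 : ℝ) = 5 ^ 2 by norm_num, ← pow_mul]
          ring
      _ ≤ 5 ^ (5 * p) := pow_le_pow_right₀ (by norm_num) (by omega)
      _ ≤ (Real.exp 1 ^ 2) ^ (5 * p) := by gcongr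
      _ = Real.exp (10 * p) := by
          rw [← pow_mul, ← Real.exp_nat_mul]
          push_cast
          ring_nf
  calc _ ≤ Real.exp (10 * p) * Real.exp (-x) := by gcongr
    _ = Real.exp (10 * p - x) := by rw [← Real.exp_add]; ring_nf
    _ ≤ _ := Real.exp_le_exp.2 (by linarith)

/-- The hypothesis yields `1000 q ≤ s²` and `1000 qn ≤ s⁴`, so `√q` and `√(qn)` are below `s/31` and
`s²/31`, since `31² < 1000`. This leaves ample room for the factors `16`. -/
lemma perturbation_small {q s n : ℝ} (hq : 0 < q) (hs : 0 < s) (hn : 0 ≤ n)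
    (h : 1000 * q * (s ^ 2 + n) / s ^ 4 < 1) :
    16 * √q ≤ s ∧ 16 * (√(q * n) + q) ≤ s ^ 2 ∧
      (4 / 3 * (√q / s + (√(q * n) + q) / s ^ 2)) ^ 2 ≤ 1000 * q * (s ^ 2 + n) / s ^ 4 := by
  rw [div_lt_one (by positivity)] at h
  have hs2 : 0 < s ^ 2 := by positivity
  have hqn : 0 ≤ q * n := by positivity
  have h1 : 1000 * q ≤ s ^ 2 := by
    by_contra! hc
    nlinarith
  have h2 : 1000 * (q * n) ≤ (s ^ 2) ^ 2 := by nlinarith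
  have hr := Real.sq_sqrt hq.le
  have hr0 := Real.sqrt_nonneg q
  have ht := Real.sq_sqrt hqn
  have ht0 := Real.sqrt_nonneg (q * n)
  have h3 : 31 * √(q * n) ≤ s ^ 2 := by
    refine le_of_sq_le_sq ?_ hs2.le
    rw [mul_pow, ht]
    linarith
  refine ⟨?_, by linarith, ?_⟩
  · refine le_of_sq_le_sq ?_ hs.le
    rw [mul_pow, hr]
    linarith
  · have h4 : 4 / 3 * (√q / s + (√(q * n) + q) / s ^ 2) =
        4 / 3 * (√q * s + √(q * n) + q) / s ^ 2 := by
      field_simp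
      ring
    rw [h4, div_pow, ← pow_mul]
    gcongr
    have h5 : (√q * s + √(q * n) + q) ^ 2 ≤ 3 * (q * s ^ 2 + q * n + q ^ 2) := by
      have h6 : (√q * s) ^ 2 = q * s ^ 2 := by rw [mul_pow, hr]
      nlinarith [sq_nonneg (√q * s - √(q * n)), sq_nonneg (√q * s - q), sq_nonneg (√(q * n) - q)]
    have h7 : q ^ 2 ≤ q * s ^ 2 := by nlinarith
    nlinarith

end Numerics

end SubspaceSVD


theorem theorem6 :
    ∃ C : ℝ, 0 < C ∧ ∀ τ : ℝ, 0 < τ →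
      ∃ α_τ c_τ : ℝ, 0 ≤ α_τ ∧ 0 < c_τ ∧
        ∀ (𝕜 : Type*) [RCLike 𝕜] (Ω : Type*) [MeasurableSpace Ω] (μ : Measure Ω)
          [IsProbabilityMeasure μ] (p₁ p₂ r : ℕ) (_ : 1 ≤ r) (h₁ : r ≤ p₁) (h₂ : r ≤ p₂)
          (X : Matrix (Fin p₁) (Fin p₂) 𝕜) (U : Matrix (Fin p₁) (Fin r) 𝕜)
          (S : Matrix (Fin r) (Fin r) 𝕜) (V : Matrix (Fin p₂) (Fin r) 𝕜)
          (Z : Ω → Matrix (Fin p₁) (Fin p₂) 𝕜),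
          X.rank = r →
          IsTruncatedSVD h₁ h₂ X U S V →
          (∀ i j, Measurable fun ω => Z ω i j) →
          iIndepFun (fun k => rowVec Z k) μ →
          (∀ k, IsIsotropic (rowVec Z k) μ) →
          (∀ k, IsSubgaussian τ (rowVec Z k) μ) →
          ∀ α : ℝ, α_τ ≤ α →
            ∃ E : Set Ω, MeasurableSet E ∧
              1 - Real.exp (-(c_τ * α * p₂)) ≤ μ.real E ∧
              ∀ ω ∈ E, ∀ (U' : Matrix (Fin p₁) (Fin r) 𝕜) (S' : Matrix (Fin r) (Fin r) 𝕜)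
                (V' : Matrix (Fin p₂) (Fin r) 𝕜),
                IsTruncatedSVD h₁ h₂ (X + Z ω) U' S' V' →
                opNorm (sinMatrix V V') ^ 2 ≤
                  min 1 (C * α * p₂ * (sval X r ^ 2 + p₁) / sval X r ^ 4) := by
  refine ⟨1000, by norm_num, fun τ hτ => ?_⟩
  set c := 1 / (12288 * (8 * (τ + 1) ^ 2) ^ 2) with hc
  have hc0 : 0 < c := by positivity
  -- `c` is the tail rate, so `α ≥ 20/c` makes the exponent at least `20 p₂`; the union bound takes
  -- half of it, hence `c/2`.
  refine ⟨20 / c, c / 2, by positivity, by positivity, ?_⟩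
  intro 𝕜 _ Ω _ μ _ p₁ p₂ r hr h₁ h₂ X U S V Z hX hSVD hZ hind hiso hsub α hα
  have hp₂ : (1 : ℝ) ≤ p₂ := by exact_mod_cast hr.trans h₂
  have hα' : 20 ≤ α * c := (div_le_iff₀ hc0).1 hα
  have hα0 : 0 < α := (by positivity : 0 < 20 / c).trans_le hα
  have hq : 0 < α * p₂ := by positivity
  obtain ⟨A, hAm, hA, hAω⟩ := exists_event (by omega : 0 < p₁) hτ hZ hind hiso hsub hq
    (LinearMap.range (Matrix.toEuclideanLin X)) (by rw [finrank_range_toEuclideanLin, hX]; exact h₂)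
  refine ⟨A, hAm, le_trans ?_ hA, fun ω hω U' S' V' hSVD' => ?_⟩
  · have h1 : 20 * (p₂ : ℝ) ≤ α * p₂ / (12288 * (8 * (τ + 1) ^ 2) ^ 2) := by
      rw [div_eq_mul_one_div, ← hc]
      nlinarith
    have h2 := five_mul_pow_mul_exp_le (hr.trans h₂) h1
    have h3 : c / 2 * α * p₂ = α * p₂ / (12288 * (8 * (τ + 1) ^ 2) ^ 2) / 2 := by
      rw [hc]
      ring
    rw [h3]
    linarith
  · have hsin : opNorm (sinMatrix V V') ≤ 1 := opNorm_sinMatrix_le zero_le_one fun k =>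
      Real.sqrt_le_one.2 (by linarith [sq_nonneg (sval (Vᴴ * V') (k + 1))])
    have hnn : 0 ≤ opNorm (sinMatrix V V') := norm_nonneg _
    have hsin1 : opNorm (sinMatrix V V') ^ 2 ≤ 1 := pow_le_one₀ hnn hsin
    refine le_min hsin1 ?_
    have hs : 0 < sval X r := sval_pos X hr hX.ge
    rw [mul_assoc 1000 α]
    -- If the right side is at least `1` the trivial bound suffices; otherwise its being below `1`
    -- is exactly what `perturbation_small` needs.
    rcases le_or_gt 1 (1000 * (α * p₂) * (sval X r ^ 2 + p₁) / sval X r ^ 4) with h | h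
    · exact hsin1.trans h
    obtain ⟨k1, k2, k3⟩ := perturbation_small hq hs (Nat.cast_nonneg p₁) h
    obtain ⟨g1, g2⟩ := hAω ω hω
    have hfin := opNorm_sinMatrix_le_of_perturbation hr h₁ h₂ hX hSVD hSVD'
      (Nat.cast_nonneg p₁) (Real.sqrt_nonneg _) k1 (by positivity) k2
      (fun x y => g1 _ (LinearMap.mem_range_self _ x) y) g2
    exact (pow_le_pow_left₀ hnn hfin 2).trans k3
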